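/- For $z=(z_1,z_2)\in\mathbb R^2$ write $z^\perp=(-z_2,z_1)$. For each small $\varepsilon>0$ let $\omega_\varepsilon:\mathbb R^2\times[0,\infty)\to\mathbb R$ with initial value $\omega_{0,\varepsilon}=\omega_\varepsilon(\cdot,0)\in L^1\cap L^\infty$, let $F_{1,\varepsilon},F_{2,\varepsilon}:\mathbb R^2\times[0,\infty)\to\mathbb R^2$ be vector fields, let $$u_\varepsilon(x,t)=\frac1{2\pi}\int_{\mathbb R^2}\frac{(x-y)^\perp}{|x-y|^2}\,\omega_\varepsilon(y,t)\,dy ,\qquad v_\varepsilon=u_\varepsilon+F_{1,\varepsilon}+F_{2,\varepsilon},$$ and suppose that each $\omega_\varepsilon(\cdot,t)$ is a rearrangement of $\omega_{0,\varepsilon}$ and that $\omega_\varepsilon$ solves $\partial_t\omega_\varepsilon+v_\varepsilon\cdot\nabla\omega_\varepsilon=0$ weakly, that is, for every smooth $\phi(x,t)$ and all $t\ge0$, $$\frac{d}{dt}\int\omega_\varepsilon\phi\,dx=\int\omega_\varepsilon\,(\partial_t\phi+v_\varepsilon\cdot\nabla\phi)\,dx .$$ Suppose moreover that there is a trajectory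 map $X_\varepsilon$ with $\frac{d}{dt}X_\varepsilon(\alpha,t)=v_\varepsilon(X_\varepsilon(\alpha,t),t)$, $X_\varepsilon(\alpha,0)=\alpha$ for all $\alpha$ and $t\ge 0$, such that $X_\varepsilon(\cdot,t)$ preserves Lebesgue measure and $\omega_\varepsilon(X_\varepsilon(\alpha,t),t)=\omega_{0,\varepsilon}(\alpha)$ for almost every $\alpha$, for all $t\ge0$. Assume that there are a point $p_0\in\mathbb R^2$ and constants $L\ge 0$, $C>0$, $M$, $\gamma>0$, $p_1>2$, and numbers $A_\varepsilon$ with $A_\varepsilon\to0$ as $\varepsilon\to0$, such that for all sufficiently small $\varepsilon>0$: 1. $|F_{1,\varepsilon}(x,t)-F_{1,\varepsilon}(y,t)|\le L|x-y|$ for all $x,y$ and all $t\ge0$, and $F_{2,\varepsilon}(\cdot,t)$ is measurable for all $t\ge 0$; 2. $\max\{\varepsilon,\ \|F_{2,\varepsilon}\|_\infty\}\le C A_\varepsilon$, where $\|F_{2,\varepsilon}\|_\infty=\sup_{x,\,t\ge0}|F_{2,\varepsilon}(x,t)|$; 3. $\omega_{0,\varepsilon}$ does not change sign and $\operatorname{supp}(\omega_{0,\varepsilon})\subset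 B_\varepsilon(p_0)$; 4. the total vorticity $\Omega_\varepsilon=\int\omega_{0,\varepsilon}\,dx$ satisfies $|\Omega_\varepsilon|\le M$; 5. $\|\omega_{0,\varepsilon}\|_{p_1}\le A_\varepsilon^{-\gamma}$. Let $p_\varepsilon(t)=\frac1{\Omega_\varepsilon}\int x\,\omega_\varepsilon(x,t)\,dx$ be the centre of vorticity. Then for every $a<\frac12$ there are $\varepsilon_0>0$ and $c_0>0$ such that for all $0<\varepsilon\le\varepsilon_0$ and all $0\le t\le c_0|\log A_\varepsilon|$, $$\operatorname{supp}(\omega_\varepsilon(\cdot,t))\subset B_{A_\varepsilon^a}(p_\varepsilon(t)).$$ Here supports are essential supports (complements of the largest open set on which the function vanishes almost everywhere), so that the case $\Omega_\varepsilon=0$, in which $\omega_\varepsilon(\cdot,t)$ vanishes almost everywhere, is trivial. -/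

import Mathlib

open MeasureTheory ProbabilityTheory Filter Topology Set
open scoped ENNReal NNReal

namespace PointVortex

/-- The Euclidean plane `ℝ²`. -/
abbrev Plane : Type := EuclideanSpace ℝ (Fin 2)

/-- Rotation by a right angle, `(z₁, z₂)^⊥ = (-z₂, z₁)`. -/
noncomputable def perp (z : Plane) : Plane := !₂[-(z 1), z 0]

/-- The Biot-Savart law
`u(x) = (1 / 2π) ∫ (x - y)^⊥ / |x - y|² ω(y) dy`. -/
noncomputable def biotSavart (ω : Plane → ℝ) (x : Plane) : Plane :=
  (1 / (2 * Real.pi)) • ∫ y, (ω y / ‖x - y‖ ^ 2) • perp (x - y)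

/-- The support of a function that is defined up to null sets: the points none of whose
neighbourhoods carries `f = 0` almost everywhere. -/
def essSupport (f : Plane → ℝ) : Set Plane :=
  {x | ∀ U ∈ 𝓝 x, ¬ (∀ᵐ y ∂(volume.restrict U), f y = 0)}

/-- The total vorticity `∫ ω dx`. -/
noncomputable def totalVorticity (ω : Plane → ℝ) : ℝ := ∫ x, ω x

/-- The centre of vorticity at time `t`, `p(t) = Ω⁻¹ ∫ x ω(x, t) dx` with `Ω = ∫ ω(x, 0) dx`. -/
noncomputable def vortexCenter (ω : ℝ → Plane → ℝ) (t : ℝ) : Plane :=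
  (totalVorticity (ω 0))⁻¹ • ∫ x, ω t x • x

/-- The full velocity field `u + F₁ + F₂` at time `t`, where `u` is recovered from `ω(·, t)` by
the Biot-Savart law. -/
noncomputable def velocity (ω : ℝ → Plane → ℝ) (F₁ F₂ : ℝ → Plane → Plane)
    (t : ℝ) (x : Plane) : Plane :=
  biotSavart (ω t) x + F₁ t x + F₂ t x

/-- `ω` solves `∂ₜ ω + v · ∇ω = 0` weakly on `[0, ∞)`: for every smooth `φ(t, x)` and every
`t ≥ 0`, `d/dt ∫ ω φ dx = ∫ ω (∂ₜ φ + v · ∇φ) dx` (one-sided derivative at `t = 0`). -/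
def IsWeakTransportSolution (ω : ℝ → Plane → ℝ) (v : ℝ → Plane → Plane) : Prop :=
  ∀ φ : ℝ → Plane → ℝ, ContDiff ℝ (⊤ : ℕ∞) (fun z : ℝ × Plane => φ z.1 z.2) →
    ∀ t : ℝ, 0 ≤ t →
      HasDerivWithinAt (fun s => ∫ x, ω s x * φ s x)
        (∫ x, ω t x * (deriv (fun s => φ s x) t + fderiv ℝ (φ t) x (v t x))) (Ici 0) t

/-- `X` is a measure preserving particle trajectory map of the velocity field `v`, that is
`dX(α, t)/dt = v(X(α, t), t)`, `X(α, 0) = α`. -/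
structure IsTrajectoryMap (v : ℝ → Plane → Plane) (X : ℝ → Plane → Plane) : Prop where
  initial : ∀ α, X 0 α = α
  ode : ∀ α, ∀ t : ℝ, 0 ≤ t →
    HasDerivWithinAt (fun s => X s α) (v t (X t α)) (Ici 0) t
  measurePreserving : ∀ t : ℝ, 0 ≤ t → MeasurePreserving (X t) volume volume

/-- `ω` is a single vortex, with initial vorticity `ω(·, 0)` in `L¹ ∩ L^∞`, that moves in the
background flow `F₁ + F₂`: each `ω(·, t)` is a rearrangement of `ω(·, 0)` (and so is in
`L¹ ∩ L^∞` too), the vorticity equation holds weakly, and `ω` is transported by a measure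
preserving trajectory map of the full velocity. -/
structure IsVortexInBackground (ω : ℝ → Plane → ℝ) (F₁ F₂ : ℝ → Plane → Plane) : Prop where
  memLp_one : MemLp (ω 0) 1 volume
  memLp_top : MemLp (ω 0) ∞ volume
  rearrangement : ∀ t : ℝ, 0 ≤ t → IdentDistrib (ω t) (ω 0) volume volume
  weak : IsWeakTransportSolution ω (velocity ω F₁ F₂)
  transport : ∃ X : ℝ → Plane → Plane, IsTrajectoryMap (velocity ω F₁ F₂) X ∧
    ∀ t : ℝ, 0 ≤ t → ∀ᵐ α, ω t (X t α) = ω 0 α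

end PointVortex

/-!
The vortex is described by its particles. Let `P` be the initial vorticity divided by its integral,
a probability measure on the particle labels, and let `Z t α` be the position of the particle `α`
relative to the centre of vorticity, which is the `P`-mean of the positions. Then `Z` has mean zero,
and its velocity is the velocity induced by the other particles plus an external part of size
`L |Z| + L ∫ |Z| + O(A)` (`IsCenteredVortex`, `IsVortexInBackground.exists_isCenteredVortex`). Every
balance law is obtained by differentiating an average over the particles along their trajectories
(`IsLipschitzFlow.hasDerivAt_integral`).

The induced velocity is antisymmetric in pairs of particles, so it does not enter the balance of the
second moment, which therefore stays of order `A²` up to a factor `exp (O(t))`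
(`IsCenteredVortex.second_moment_le`).

For the mass far from the centre, let `ρ = A ^ b` with `a < b < 1 / 2` and consider the average of
`(ρ⁴ + |Z|⁴) ^ n`. The pair interactions are symmetrised, and a term linear in one of the points is
removed, as it averages to zero. What is left is quadratic in one point and contributes at most the
second moment times the average of `(ρ⁴ + |Z|⁴) ^ (n - 1)` (`abs_symm_interaction_le`,
`CenteredCloud.abs_integral_weight_inner_le`). The second moment is below `ρ⁴` precisely because
`b < 1 / 2`, so the weighted average grows at a rate depending on `n` but not on `A`
(`IsCenteredVortex.weight_moment_le`). By Markov's inequality with `n` large, on a time interval of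
length `c₀ |log A|` the mass outside a disc of radius `A ^ a'`, `a' < b`, is smaller than any power
of `A` fixed beforehand.

Finally, the radial velocity at distance `r ≥ A ^ a'` consists of a contribution of the bulk, of
order (second moment) `/ r³ ≤ r`, a contribution of the mass outside the disc of radius `r / 2`,
which is negligible because the `L^p` bound with `p > 2` limits how strongly a small mass can act
(`exists_lintegral_potential_le`), and the external part. All are `O(r)`, so a particle outside that
disc moves away from the centre at most exponentially fast (`IsCenteredVortex.sq_norm_le`), and for
small `c₀` no particle reaches distance `A ^ a` before the time `c₀ |log A|`
(`exists_forall_norm_lt`).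
-/

namespace PointVortex

/-! ### The rotation and the Biot-Savart kernel -/

/-- The rotation `perp` as a continuous linear map. -/
noncomputable def perpL : Plane →L[ℝ] Plane :=
  LinearMap.toContinuousLinearMap
    { toFun := perp
      map_add' := fun x y => by
        ext i; fin_cases i <;> simp [perp]; ring
      map_smul' := fun c x => by
        ext i; fin_cases i <;> simp [perp] }

@[simp] lemma perpL_apply (x : Plane) : perpL x = perp x := rfl

lemma perp_sub (x y : Plane) : perp (x - y) = perp x - perp y := map_sub perpL x y

lemma perp_neg (x : Plane) : perp (-x) = -perp x := map_neg perpL x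

lemma continuous_perp : Continuous perp := perpL.continuous

lemma norm_perp (x : Plane) : ‖perp x‖ = ‖x‖ := by
  rw [EuclideanSpace.norm_eq, EuclideanSpace.norm_eq]
  simp [perp, Fin.sum_univ_two, add_comm]

lemma inner_perp_self (x : Plane) : inner ℝ x (perp x) = 0 := by
  simp [perp, PiLp.inner_apply, Fin.sum_univ_two]; ring

lemma inner_perp_comm (x y : Plane) : inner ℝ y (perp x) = -inner ℝ x (perp y) := by
  simp [perp, PiLp.inner_apply, Fin.sum_univ_two]; ring

lemma abs_sub_le_abs_add_abs (a b : ℝ) : |a - b| ≤ |a| + |b| := norm_sub_le a b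

/-- The Biot-Savart kernel without its factor `1 / 2π`. -/
noncomputable def kernel (z : Plane) : Plane := (1 / ‖z‖ ^ 2) • perp z

lemma kernel_neg (z : Plane) : kernel (-z) = -kernel z := by
  simp [kernel, perp_neg]

lemma norm_kernel (z : Plane) : ‖kernel z‖ = 1 / ‖z‖ := by
  rw [kernel, norm_smul, norm_perp, norm_div, norm_pow, norm_norm, norm_one]
  rcases eq_or_ne ‖z‖ 0 with h | h
  · simp [h]
  · field_simp

lemma measurable_kernel : Measurable kernel := by
  unfold kernel
  have := continuous_perp.measurable
  fun_prop

lemma inner_kernel (x y : Plane) :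
    inner ℝ x (kernel (x - y)) = -(inner ℝ x (perp y) / ‖x - y‖ ^ 2) := by
  rw [kernel, inner_smul_right, perp_sub, inner_sub_right, inner_perp_self]
  ring

lemma abs_inner_perp_le (x y : Plane) : |inner ℝ x (perp y)| ≤ ‖x‖ * ‖y‖ := by
  simpa [norm_perp] using abs_real_inner_le_norm x (perp y)

lemma abs_inner_perp_le_left (x y : Plane) : |inner ℝ x (perp y)| ≤ ‖x‖ * ‖x - y‖ := by
  have h : inner ℝ x (perp y) = -inner ℝ x (perp (x - y)) := by
    rw [perp_sub, inner_sub_right, inner_perp_self]; ring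
  rw [h, abs_neg]
  exact abs_inner_perp_le _ _

lemma abs_inner_perp_le_right (x y : Plane) : |inner ℝ x (perp y)| ≤ ‖y‖ * ‖x - y‖ := by
  have h := abs_inner_perp_le_left y x
  rwa [inner_perp_comm, abs_neg, norm_sub_rev] at h

/-- Far from the origin, the radial component of the kernel is, up to a quadratic error, linear
in the source point `y`; the linear part disappears on averaging over a centred vortex. -/
lemma abs_radial_kernel_far {x y : Plane} (hx : x ≠ 0) (hy : ‖y‖ ≤ ‖x‖ / 2) :
    |inner ℝ x (perp y) / ‖x - y‖ ^ 2 - inner ℝ x (perp y) / ‖x‖ ^ 2|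
      ≤ 12 * ‖y‖ ^ 2 / ‖x‖ ^ 2 := by
  have hr : 0 < ‖x‖ := norm_pos_iff.2 hx
  have hd : ‖x‖ / 2 ≤ ‖x - y‖ := by
    have := norm_sub_norm_le x y; linarith
  have hd0 : 0 < ‖x - y‖ := by linarith
  have hsq : ‖x - y‖ ^ 2 = ‖x‖ ^ 2 - 2 * inner ℝ x y + ‖y‖ ^ 2 := norm_sub_sq_real x y
  have he := abs_le.1 (abs_real_inner_le_norm x y)
  have hc := abs_inner_perp_le x y
  have h1 : inner ℝ x (perp y) / ‖x - y‖ ^ 2 - inner ℝ x (perp y) / ‖x‖ ^ 2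
      = inner ℝ x (perp y) * (2 * inner ℝ x y - ‖y‖ ^ 2) / (‖x - y‖ ^ 2 * ‖x‖ ^ 2) := by
    field_simp
    rw [hsq]; ring
  have h2 : |2 * inner ℝ x y - ‖y‖ ^ 2| ≤ 3 * ‖x‖ * ‖y‖ := by
    rw [abs_le]
    constructor <;> nlinarith [norm_nonneg y, mul_nonneg hr.le (norm_nonneg y)]
  rw [h1, abs_div, abs_mul, abs_of_pos (by positivity : 0 < ‖x - y‖ ^ 2 * ‖x‖ ^ 2),
    div_le_div_iff₀ (by positivity) (by positivity)]
  have h3 : |inner ℝ x (perp y)| * |2 * inner ℝ x y - ‖y‖ ^ 2|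
      ≤ (‖x‖ * ‖y‖) * (3 * ‖x‖ * ‖y‖) := by gcongr
  have h4 : ‖x‖ ^ 2 ≤ 4 * ‖x - y‖ ^ 2 := by nlinarith
  calc _ ≤ (‖x‖ * ‖y‖) * (3 * ‖x‖ * ‖y‖) * ‖x‖ ^ 2 := by gcongr
    _ = 3 * ‖y‖ ^ 2 * ‖x‖ ^ 2 * ‖x‖ ^ 2 := by ring
    _ ≤ 3 * ‖y‖ ^ 2 * ‖x‖ ^ 2 * (4 * ‖x - y‖ ^ 2) := by gcongr
    _ = _ := by ring

/-- For source points away from the origin nothing is gained from the cancellation, and the kernel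
is bounded by its size. -/
lemma abs_radial_kernel_near {x y : Plane} (hx : x ≠ 0) (hy : ‖x‖ / 2 < ‖y‖) :
    |inner ℝ x (perp y) / ‖x - y‖ ^ 2 - inner ℝ x (perp y) / ‖x‖ ^ 2|
      ≤ 12 * ‖y‖ ^ 2 / ‖x‖ ^ 2 + ‖x‖ * (1 / ‖x - y‖) := by
  have hr : 0 < ‖x‖ := norm_pos_iff.2 hx
  have h1 : |inner ℝ x (perp y) / ‖x - y‖ ^ 2| ≤ ‖x‖ * (1 / ‖x - y‖) := by
    rcases eq_or_ne ‖x - y‖ 0 with h | h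
    · simp [h]
    · have := abs_inner_perp_le_left x y
      have h0 : 0 < ‖x - y‖ := lt_of_le_of_ne (norm_nonneg _) h.symm
      rw [abs_div, abs_of_pos (by positivity : 0 < ‖x - y‖ ^ 2), div_le_iff₀ (by positivity)]
      calc _ ≤ _ := this
        _ = _ := by field_simp
  have h2 : |inner ℝ x (perp y) / ‖x‖ ^ 2| ≤ 12 * ‖y‖ ^ 2 / ‖x‖ ^ 2 := by
    rw [abs_div, abs_of_pos (by positivity : 0 < ‖x‖ ^ 2)]
    gcongr
    refine (abs_inner_perp_le x y).trans ?_
    nlinarith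
  refine (abs_sub_le_abs_add_abs _ _).trans ?_
  linarith

/-! ### The weight `(ρ⁴ + |z|⁴) ^ n` -/

/-- The weight `(ρ⁴ + |z|⁴) ^ n` has gradient `|z|² (weightDensity ρ n z) z`. -/
noncomputable def weightDensity (ρ : ℝ) (n : ℕ) (z : Plane) : ℝ :=
  4 * n * (ρ ^ 4 + ‖z‖ ^ 4) ^ (n - 1)

lemma weightDensity_nonneg (ρ : ℝ) (n : ℕ) (z : Plane) : 0 ≤ weightDensity ρ n z := by
  unfold weightDensity; positivity

lemma weightDensity_mono {ρ : ℝ} {n : ℕ} {x y : Plane} (h : ‖y‖ ≤ ‖x‖) :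
    weightDensity ρ n y ≤ weightDensity ρ n x := by
  unfold weightDensity; gcongr

lemma continuous_weightDensity (ρ : ℝ) (n : ℕ) : Continuous (weightDensity ρ n) := by
  unfold weightDensity; fun_prop

/-- The mean value estimate for `s ↦ s (a + s²) ^ m`. -/
lemma mul_pow_sub_mul_pow_le {a s t : ℝ} (ha : 0 ≤ a) (ht : 0 ≤ t) (hts : t ≤ s) (m : ℕ) :
    s * (a + s ^ 2) ^ m - t * (a + t ^ 2) ^ m ≤ (2 * m + 1) * (a + s ^ 2) ^ m * (s - t) := by
  induction m with
  | zero => simp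
  | succ m ih =>
    have hs : 0 ≤ s := ht.trans hts
    have h1 : t ^ 2 ≤ s ^ 2 := by gcongr
    have hS : 0 ≤ (a + s ^ 2) ^ m := by positivity
    have hT : (a + t ^ 2) ^ m ≤ (a + s ^ 2) ^ m := by gcongr
    have hT0 : 0 ≤ (a + t ^ 2) ^ m := by positivity
    have e1 : s * (a + s ^ 2) ^ (m + 1) - t * (a + t ^ 2) ^ (m + 1)
        = (s * (a + s ^ 2) ^ m - t * (a + t ^ 2) ^ m) * (a + s ^ 2)
          + t * (a + t ^ 2) ^ m * (s + t) * (s - t) := by ring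
    have e2 : t * (a + t ^ 2) ^ m * (s + t) ≤ 2 * ((a + s ^ 2) ^ m * (a + s ^ 2)) := by
      calc t * (a + t ^ 2) ^ m * (s + t) ≤ s * (a + s ^ 2) ^ m * (s + s) := by gcongr
        _ ≤ _ := by nlinarith
    have e3 : (s * (a + s ^ 2) ^ m - t * (a + t ^ 2) ^ m) * (a + s ^ 2)
        ≤ ((2 * m + 1) * (a + s ^ 2) ^ m * (s - t)) * (a + s ^ 2) := by gcongr
    have e4 : t * (a + t ^ 2) ^ m * (s + t) * (s - t)
        ≤ 2 * ((a + s ^ 2) ^ m * (a + s ^ 2)) * (s - t) :=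
      mul_le_mul_of_nonneg_right e2 (by linarith)
    rw [e1]
    push_cast
    calc _ ≤ _ := add_le_add e3 e4
      _ = _ := by ring

lemma sq_mul_weightDensity_sub_le {ρ : ℝ} {n : ℕ} (hn : 1 ≤ n) {x y : Plane} (h : ‖y‖ ≤ ‖x‖) :
    ‖x‖ ^ 2 * weightDensity ρ n x - ‖y‖ ^ 2 * weightDensity ρ n y
      ≤ 2 * n * weightDensity ρ n x * (‖x‖ ^ 2 - ‖y‖ ^ 2) := by
  have h1 : ‖y‖ ^ 2 ≤ ‖x‖ ^ 2 := by gcongr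
  have h2 := mul_pow_sub_mul_pow_le (a := ρ ^ 4) (by positivity) (by positivity) h1 (n - 1)
  have h3 : (2 * ((n - 1 : ℕ) : ℝ) + 1) ≤ 2 * n := by
    rw [Nat.cast_sub hn]; push_cast; linarith
  have e : ∀ z : Plane, (‖z‖ ^ 2) ^ 2 = ‖z‖ ^ 4 := fun z => by ring
  rw [e, e] at h2
  unfold weightDensity
  have hd : 0 ≤ ‖x‖ ^ 2 - ‖y‖ ^ 2 := by linarith
  calc _ = 4 * n * (‖x‖ ^ 2 * (ρ ^ 4 + ‖x‖ ^ 4) ^ (n - 1)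
        - ‖y‖ ^ 2 * (ρ ^ 4 + ‖y‖ ^ 4) ^ (n - 1)) := by ring
    _ ≤ 4 * n * ((2 * ((n - 1 : ℕ) : ℝ) + 1) * (ρ ^ 4 + ‖x‖ ^ 4) ^ (n - 1)
          * (‖x‖ ^ 2 - ‖y‖ ^ 2)) := by gcongr
    _ ≤ 4 * n * ((2 * n) * (ρ ^ 4 + ‖x‖ ^ 4) ^ (n - 1) * (‖x‖ ^ 2 - ‖y‖ ^ 2)) := by gcongr
    _ = _ := by ring

/-- The case `‖y‖ ≤ ‖x‖` of `abs_symm_interaction_le`. For `‖y‖ ≤ ‖x‖ / 2` the subtracted term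
cancels the leading part of the kernel; otherwise the difference of the weights cancels its
singularity. -/
lemma abs_symm_interaction_le_aux {ρ : ℝ} {n : ℕ} (hn : 1 ≤ n) {x y : Plane} (h : ‖y‖ ≤ ‖x‖) :
    |(‖x‖ ^ 2 * weightDensity ρ n x - ‖y‖ ^ 2 * weightDensity ρ n y)
        * (inner ℝ x (perp y) / ‖x - y‖ ^ 2)
      - inner ℝ x (perp y) * (weightDensity ρ n x - weightDensity ρ n y)|
      ≤ (8 * n + 20) * (‖y‖ ^ 2 * weightDensity ρ n x + ‖x‖ ^ 2 * weightDensity ρ n y) := by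
  set c := inner ℝ x (perp y) with hc
  set G := weightDensity ρ n x with hG
  set H := weightDensity ρ n y with hH
  have hG0 : 0 ≤ G := weightDensity_nonneg _ _ _
  have hH0 : 0 ≤ H := weightDensity_nonneg _ _ _
  have hHG : H ≤ G := weightDensity_mono h
  have hn' : (1 : ℝ) ≤ n := by exact_mod_cast hn
  have hx0 := norm_nonneg x
  have hy0 := norm_nonneg y
  rcases eq_or_ne (‖x - y‖) 0 with h0 | h0
  · have hxy : x = y := sub_eq_zero.1 (norm_eq_zero.1 h0)
    have : c = 0 := by rw [hc, hxy, inner_perp_self]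
    rw [this]; simp; positivity
  have hd0 : 0 < ‖x - y‖ := lt_of_le_of_ne (norm_nonneg _) h0.symm
  have hcx : |c| ≤ ‖x‖ * ‖y‖ := abs_inner_perp_le x y
  have hcy : |c| ≤ ‖y‖ * ‖x - y‖ := abs_inner_perp_le_right x y
  rcases le_total ‖y‖ (‖x‖ / 2) with hy | hy
  · have hd : ‖x‖ / 2 ≤ ‖x - y‖ := by
      have := norm_sub_norm_le x y; linarith
    have hx : 0 < ‖x‖ := by
      rcases hx0.eq_or_lt with h' | h'
      · have hy' : ‖y‖ = 0 := by linarith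
        have := norm_sub_le x y
        linarith
      · exact h'
    have hsq : ‖x - y‖ ^ 2 = ‖x‖ ^ 2 - 2 * inner ℝ x y + ‖y‖ ^ 2 := norm_sub_sq_real x y
    have he := abs_real_inner_le_norm x y
    have e1 : (‖x‖ ^ 2 * G - ‖y‖ ^ 2 * H) * (c / ‖x - y‖ ^ 2) - c * (G - H)
        = c / ‖x - y‖ ^ 2 * (2 * inner ℝ x y * (G - H) - G * ‖y‖ ^ 2 + H * ‖x‖ ^ 2) := by
      field_simp
      rw [hsq]; ring
    have e2 : |2 * inner ℝ x y * (G - H) - G * ‖y‖ ^ 2 + H * ‖x‖ ^ 2|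
        ≤ 3 * ‖x‖ * ‖y‖ * G + ‖x‖ ^ 2 * H := by
      have he' : |inner ℝ x y * (G - H)| ≤ ‖x‖ * ‖y‖ * G := by
        rw [abs_mul, abs_of_nonneg (by linarith : 0 ≤ G - H)]
        gcongr; linarith
      have := abs_le.1 he'
      have h5 : G * ‖y‖ ^ 2 ≤ ‖x‖ * ‖y‖ * G := by nlinarith [mul_nonneg hy0 hG0]
      have h6 : 0 ≤ H * ‖x‖ ^ 2 := by positivity
      have h7 : 0 ≤ G * ‖y‖ ^ 2 := by positivity
      have h8 : 0 ≤ ‖x‖ * ‖y‖ * G := by positivity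
      rw [abs_le]
      constructor <;> nlinarith
    have e3 : |c / ‖x - y‖ ^ 2| ≤ 4 * ‖y‖ / ‖x‖ := by
      rw [abs_div, abs_of_pos (by positivity : 0 < ‖x - y‖ ^ 2),
        div_le_div_iff₀ (by positivity) hx]
      have : ‖x‖ ^ 2 ≤ 4 * ‖x - y‖ ^ 2 := by nlinarith
      calc |c| * ‖x‖ ≤ ‖x‖ * ‖y‖ * ‖x‖ := by gcongr
        _ = ‖y‖ * ‖x‖ ^ 2 := by ring
        _ ≤ ‖y‖ * (4 * ‖x - y‖ ^ 2) := by gcongr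
        _ = _ := by ring
    rw [e1, abs_mul]
    calc _ ≤ 4 * ‖y‖ / ‖x‖ * (3 * ‖x‖ * ‖y‖ * G + ‖x‖ ^ 2 * H) := by gcongr
      _ = 12 * (‖y‖ ^ 2 * G) + 4 * (‖y‖ * ‖x‖) * H := by field_simp; ring
      _ ≤ 20 * (‖y‖ ^ 2 * G) + 4 * (‖x‖ * ‖x‖) * H := by gcongr; norm_num
      _ = 20 * (‖y‖ ^ 2 * G) + 4 * (‖x‖ ^ 2 * H) := by ring
      _ ≤ _ := by
        have h7 : 0 ≤ ‖y‖ ^ 2 * G := by positivity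
        have h8 : 0 ≤ ‖x‖ ^ 2 * H := by positivity
        nlinarith
  · have hxy : ‖x‖ ≤ 2 * ‖y‖ := by linarith
    have hdiff : ‖x‖ ^ 2 - ‖y‖ ^ 2 ≤ ‖x - y‖ * (2 * ‖x‖) := by
      have := norm_sub_norm_le x y
      calc ‖x‖ ^ 2 - ‖y‖ ^ 2 = (‖x‖ - ‖y‖) * (‖x‖ + ‖y‖) := by ring
        _ ≤ ‖x - y‖ * (2 * ‖x‖) := by gcongr; linarith
    have e1 : |(‖x‖ ^ 2 * G - ‖y‖ ^ 2 * H) * (c / ‖x - y‖ ^ 2)| ≤ 8 * n * (‖y‖ ^ 2 * G) := by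
      have h1 : 0 ≤ ‖x‖ ^ 2 * G - ‖y‖ ^ 2 * H := by
        have : ‖y‖ ^ 2 * H ≤ ‖x‖ ^ 2 * G := by gcongr
        linarith
      rw [abs_mul, abs_of_nonneg h1, abs_div, abs_of_pos (by positivity : 0 < ‖x - y‖ ^ 2),
        ← mul_div_assoc, div_le_iff₀ (by positivity)]
      calc _ ≤ (2 * n * G * (‖x - y‖ * (2 * ‖x‖))) * (‖y‖ * ‖x - y‖) := by
            refine mul_le_mul ?_ hcy (abs_nonneg _) (by positivity)
            refine (sq_mul_weightDensity_sub_le hn h).trans ?_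
            gcongr
        _ = 4 * n * (‖x‖ * ‖y‖ * G) * ‖x - y‖ ^ 2 := by ring
        _ ≤ 4 * n * (2 * ‖y‖ * ‖y‖ * G) * ‖x - y‖ ^ 2 := by gcongr
        _ = _ := by ring
    have e2 : |c * (G - H)| ≤ 2 * (‖y‖ ^ 2 * G) := by
      rw [abs_mul, abs_of_nonneg (by linarith : 0 ≤ G - H)]
      calc _ ≤ (‖x‖ * ‖y‖) * G := by gcongr; linarith
        _ ≤ (2 * ‖y‖ * ‖y‖) * G := by gcongr
        _ = _ := by ring
    have h7 : 0 ≤ ‖y‖ ^ 2 * G := by positivity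
    have h8 : 0 ≤ ‖x‖ ^ 2 * H := by positivity
    refine (abs_sub_le_abs_add_abs _ _).trans ?_
    have h9 : 0 ≤ n * (‖x‖ ^ 2 * H) := by positivity
    linarith

/-- The symmetrised self-interaction in the evolution of the weight `(ρ⁴ + |z|⁴) ^ n`, once the
part linear in one of the two points is removed, is quadratic in one point and of order
`weightDensity` in the other. -/
lemma abs_symm_interaction_le {ρ : ℝ} {n : ℕ} (hn : 1 ≤ n) (x y : Plane) :
    |(‖x‖ ^ 2 * weightDensity ρ n x - ‖y‖ ^ 2 * weightDensity ρ n y)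
        * (inner ℝ x (perp y) / ‖x - y‖ ^ 2)
      - inner ℝ x (perp y) * (weightDensity ρ n x - weightDensity ρ n y)|
      ≤ (8 * n + 20) * (‖y‖ ^ 2 * weightDensity ρ n x + ‖x‖ ^ 2 * weightDensity ρ n y) := by
  rcases le_total ‖y‖ ‖x‖ with h | h
  · exact abs_symm_interaction_le_aux hn h
  · have := abs_symm_interaction_le_aux (ρ := ρ) hn h
    rw [inner_perp_comm, norm_sub_rev] at this
    convert this using 1
    · congr 1; ring
    · ring
/-! ### Centred random points and their self-induced velocity -/

/-- A random point `z` of the plane whose law is so little concentrated that `1 / |x - z|`, cut off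
to `|x - z| < s`, has mean at most `q s ^ σ`. -/
structure SpreadCloud {S : Type*} [MeasurableSpace S] (P : Measure S) (z : S → Plane)
    (q σ : ℝ) : Prop where
  measurable : Measurable z
  nonneg : 0 ≤ q
  spread : ∀ x : Plane, ∀ s : ℝ, 0 < s →
    ∫⁻ β in {β | ‖x - z β‖ < s}, ENNReal.ofReal (1 / ‖x - z β‖) ∂P ≤ ENNReal.ofReal (q * s ^ σ)

/-- A spread cloud that is bounded and has mean zero. -/
structure CenteredCloud {S : Type*} [MeasurableSpace S] (P : Measure S) (z : S → Plane)
    (q σ : ℝ) : Prop extends SpreadCloud P z q σ where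
  bounded : ∃ D : ℝ, ∀ᵐ α ∂P, ‖z α‖ ≤ D
  mean : ∫ α, z α ∂P = 0

/-- The velocity that the law of `z` induces at `x`, without the factor `1 / 2π`. -/
noncomputable def selfVelocity {S : Type*} [MeasurableSpace S] (P : Measure S) (z : S → Plane)
    (x : Plane) : Plane := ∫ β, kernel (x - z β) ∂P

namespace SpreadCloud

variable {S : Type*} [MeasurableSpace S] {P : Measure S} [IsProbabilityMeasure P]
  {z : S → Plane} {q σ : ℝ}

lemma lintegral_le (h : SpreadCloud P z q σ) (x : Plane) :
    ∫⁻ β, ENNReal.ofReal (1 / ‖x - z β‖) ∂P ≤ ENNReal.ofReal (q + 1) := by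
  have hz := h.measurable
  have hm : MeasurableSet {β | ‖x - z β‖ < 1} := by measurability
  rw [← lintegral_add_compl _ hm, ENNReal.ofReal_add h.nonneg zero_le_one]
  refine add_le_add (by simpa using h.spread x 1 one_pos) ?_
  calc _ ≤ ∫⁻ β in {β | ‖x - z β‖ < 1}ᶜ, 1 ∂P := by
        refine setLIntegral_mono' hm.compl fun β hβ => ?_
        rw [← ENNReal.ofReal_one]
        refine ENNReal.ofReal_le_ofReal ?_
        simp only [mem_compl_iff, mem_ofPred_eq, not_lt] at hβ
        rw [div_le_one (by linarith)]
        exact hβ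
    _ ≤ _ := by
        rw [setLIntegral_one, ENNReal.ofReal_one]
        exact prob_le_one

lemma integrable_inv (h : SpreadCloud P z q σ) (x : Plane) :
    Integrable (fun β => 1 / ‖x - z β‖) P := by
  have hz := h.measurable
  refine ⟨(by fun_prop : Measurable _).aestronglyMeasurable, ?_⟩
  rw [hasFiniteIntegral_iff_ofReal (ae_of_all _ fun β => by positivity)]
  exact (h.lintegral_le x).trans_lt ENNReal.ofReal_lt_top

lemma integral_inv_le (h : SpreadCloud P z q σ) (x : Plane) :
    ∫ β, 1 / ‖x - z β‖ ∂P ≤ q + 1 := by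
  have h0 := h.nonneg
  rw [integral_eq_lintegral_of_nonneg_ae (ae_of_all _ fun β => by positivity)
    (h.integrable_inv x).aestronglyMeasurable]
  exact ENNReal.toReal_le_of_le_ofReal (by linarith) (h.lintegral_le x)

lemma integrable_kernel (h : SpreadCloud P z q σ) (x : Plane) :
    Integrable (fun β => kernel (x - z β)) P := by
  have hz := h.measurable
  refine (h.integrable_inv x).mono'
    (measurable_kernel.comp (by fun_prop)).aestronglyMeasurable (ae_of_all _ fun β => ?_)
  rw [norm_kernel]

lemma norm_selfVelocity_le (h : SpreadCloud P z q σ) (x : Plane) :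
    ‖selfVelocity P z x‖ ≤ q + 1 := by
  refine (norm_integral_le_integral_norm _).trans ?_
  simp only [norm_kernel]
  exact h.integral_inv_le x

lemma integrable_kernel_prod (h : SpreadCloud P z q σ) :
    Integrable (fun p : S × S => kernel (z p.1 - z p.2)) (P.prod P) := by
  have hz := h.measurable
  have hm : Measurable (fun p : S × S => kernel (z p.1 - z p.2)) :=
    measurable_kernel.comp (by fun_prop)
  refine ⟨hm.aestronglyMeasurable, ?_⟩
  rw [hasFiniteIntegral_iff_norm, lintegral_prod _ hm.norm.ennreal_ofReal.aemeasurable]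
  calc _ ≤ ∫⁻ _, ENNReal.ofReal (q + 1) ∂P := by
        refine lintegral_mono fun α => ?_
        simp only [norm_kernel]
        exact h.lintegral_le _
    _ < _ := by simp

lemma measurable_selfVelocity_comp (h : SpreadCloud P z q σ) :
    StronglyMeasurable (fun α => selfVelocity P z (z α)) := by
  have hz := h.measurable
  have hm : Measurable (fun p : S × S => kernel (z p.1 - z p.2)) :=
    measurable_kernel.comp (by fun_prop)
  exact hm.stronglyMeasurable.integral_prod_right'

lemma integral_selfVelocity (h : SpreadCloud P z q σ) :
    ∫ α, selfVelocity P z (z α) ∂P = 0 := by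
  have h1 : ∫ α, selfVelocity P z (z α) ∂P
      = ∫ p : S × S, kernel (z p.1 - z p.2) ∂(P.prod P) :=
    (integral_prod _ h.integrable_kernel_prod).symm
  have h2 : ∫ p : S × S, kernel (z p.1 - z p.2) ∂(P.prod P)
      = -∫ p : S × S, kernel (z p.1 - z p.2) ∂(P.prod P) := by
    conv_lhs => rw [← integral_prod_swap]
    rw [← integral_neg]
    refine integral_congr_ae (ae_of_all _ fun p => ?_)
    simp only [Prod.fst_swap, Prod.snd_swap]
    rw [← kernel_neg, neg_sub]
  rw [h1]
  have h3 : (2 : ℝ) • ∫ p : S × S, kernel (z p.1 - z p.2) ∂(P.prod P) = 0 := by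
    rw [two_smul]
    exact eq_neg_iff_add_eq_zero.1 h2
  exact (smul_eq_zero.1 h3).resolve_left two_ne_zero

end SpreadCloud

namespace CenteredCloud

variable {S : Type*} [MeasurableSpace S] {P : Measure S} [IsProbabilityMeasure P]
  {z : S → Plane} {q σ : ℝ}

lemma integrable_comp (h : CenteredCloud P z q σ) {E : Type*} [NormedAddCommGroup E]
    [SecondCountableTopology E] [MeasurableSpace E] [BorelSpace E]
    {f : Plane → E} (hf : Continuous f) : Integrable (fun α => f (z α)) P := by
  obtain ⟨D, hD⟩ := h.bounded
  obtain ⟨B, hB⟩ := (isCompact_closedBall (0 : Plane) D).exists_bound_of_continuousOn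
    hf.continuousOn
  refine Integrable.of_bound (hf.measurable.comp h.measurable).aestronglyMeasurable B ?_
  filter_upwards [hD] with α hα
  exact hB _ (by simpa using hα)

lemma integrable_prod_comp (h : CenteredCloud P z q σ) {f : Plane → Plane → ℝ}
    (hf : Continuous (fun p : Plane × Plane => f p.1 p.2)) :
    Integrable (fun p : S × S => f (z p.1) (z p.2)) (P.prod P) := by
  have hz := h.measurable
  obtain ⟨D, hD⟩ := h.bounded
  obtain ⟨B, hB⟩ := ((isCompact_closedBall (0 : Plane) D).prod
    (isCompact_closedBall (0 : Plane) D)).exists_bound_of_continuousOn hf.continuousOn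
  have hm : Measurable (fun p : S × S => (z p.1, z p.2)) := by fun_prop
  refine Integrable.of_bound (hf.measurable.comp hm).aestronglyMeasurable B ?_
  filter_upwards [Measure.quasiMeasurePreserving_fst.ae hD,
    Measure.quasiMeasurePreserving_snd.ae hD] with p h1 h2
  exact hB (z p.1, z p.2) (by simpa using ⟨h1, h2⟩)

/-- Symmetrisation of the self-interaction. A multiple of `⟨x, y^⊥⟩ (G x - G y)` can be
subtracted for free because the cloud is centred. -/
lemma two_mul_integral_weight_inner (h : CenteredCloud P z q σ) {w G : Plane → ℝ}
    (hw : Continuous w) (hG : Continuous G) :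
    2 * ∫ α, w (z α) * inner ℝ (z α) (selfVelocity P z (z α)) ∂P
      = -∫ p : S × S, ((w (z p.1) - w (z p.2))
            * (inner ℝ (z p.1) (perp (z p.2)) / ‖z p.1 - z p.2‖ ^ 2)
          - inner ℝ (z p.1) (perp (z p.2)) * (G (z p.1) - G (z p.2))) ∂(P.prod P) := by
  have hz := h.measurable
  have hcp := continuous_perp
  set f : S × S → ℝ := fun p => inner ℝ (w (z p.1) • z p.1) (kernel (z p.1 - z p.2)) with hf
  have hfi : Integrable f (P.prod P) := by
    obtain ⟨D, hD⟩ := h.bounded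
    obtain ⟨B, hB⟩ := (isCompact_closedBall (0 : Plane) D).exists_bound_of_continuousOn
      (f := fun x : Plane => w x • x) (by fun_prop)
    have hm : Measurable f :=
      Measurable.inner (by fun_prop) (measurable_kernel.comp (by fun_prop))
    refine (h.integrable_kernel_prod.norm.const_mul B).mono' hm.aestronglyMeasurable ?_
    filter_upwards [Measure.quasiMeasurePreserving_fst.ae hD] with p hp
    refine (norm_inner_le_norm _ _).trans ?_
    gcongr
    exact hB _ (by simpa using hp)
  have hfs : Integrable (fun p : S × S => f p.swap) (P.prod P) := hfi.swap
  set c : S × S → ℝ := fun p => inner ℝ (z p.1) (perp (z p.2)) * G (z p.1) with hc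
  have hci : Integrable c (P.prod P) :=
    h.integrable_prod_comp (f := fun x y => inner ℝ x (perp y) * G x) (by fun_prop)
  have hcs : Integrable (fun p : S × S => c p.swap) (P.prod P) := hci.swap
  have hc0 : ∫ p, c p ∂(P.prod P) = 0 := by
    rw [integral_prod _ hci]
    have : ∀ α, ∫ β, c (α, β) ∂P = 0 := fun α => by
      have hi : Integrable (fun β => perp (z β)) P := h.integrable_comp hcp
      have hp : ∫ β, perp (z β) ∂P = 0 := by
        have := perpL.integral_comp_comm (h.integrable_comp continuous_id)
        simp only [id, perpL_apply] at this
        rw [this, h.mean, ← perpL_apply, map_zero]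
      simp only [hc]
      rw [integral_mul_const, integral_inner hi, hp, inner_zero_right, zero_mul]
    simp [this]
  have hcs0 : ∫ p : S × S, c p.swap ∂(P.prod P) = 0 := by rw [integral_prod_swap, hc0]
  have h1 : ∫ α, w (z α) * inner ℝ (z α) (selfVelocity P z (z α)) ∂P
      = ∫ p, f p ∂(P.prod P) := by
    rw [integral_prod _ hfi]
    refine integral_congr_ae (ae_of_all _ fun α => ?_)
    simp only [hf]
    rw [integral_inner (h.integrable_kernel _), inner_smul_left]
    rfl
  have h2 : ∫ p : S × S, f p.swap ∂(P.prod P) = ∫ p, f p ∂(P.prod P) := integral_prod_swap _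
  have h3 : ∫ p : S × S, ((f p + f p.swap) + (c p + c p.swap)) ∂(P.prod P)
      = 2 * ∫ p, f p ∂(P.prod P) := by
    have hA : Integrable (fun p : S × S => f p + f p.swap) (P.prod P) := hfi.add hfs
    have hB : Integrable (fun p : S × S => c p + c p.swap) (P.prod P) := hci.add hcs
    rw [integral_add hA hB, integral_add hfi hfs, integral_add hci hcs,
      hc0, hcs0, h2]
    ring
  rw [h1, ← h3, ← integral_neg]
  refine integral_congr_ae (ae_of_all _ fun p => ?_)
  simp only [hf, hc, Prod.fst_swap, Prod.snd_swap, inner_smul_left, inner_kernel,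
    RCLike.conj_to_real]
  rw [inner_perp_comm (z p.1) (z p.2), norm_sub_rev (z p.2) (z p.1)]
  ring

lemma integral_inner_selfVelocity (h : CenteredCloud P z q σ) :
    ∫ α, inner ℝ (z α) (selfVelocity P z (z α)) ∂P = 0 := by
  have := h.two_mul_integral_weight_inner (w := fun _ => 1) (G := fun _ => 0)
    continuous_const continuous_const
  simpa using this

/-- The self-interaction contributes to the growth of `∫ (ρ⁴ + |z|⁴) ^ n` no more than the second
moment times a moment of lower order. -/
lemma abs_integral_weight_inner_le (h : CenteredCloud P z q σ) (ρ : ℝ) {n : ℕ} (hn : 1 ≤ n) :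
    |∫ α, ‖z α‖ ^ 2 * weightDensity ρ n (z α) * inner ℝ (z α) (selfVelocity P z (z α)) ∂P|
      ≤ (8 * n + 20) * (∫ α, ‖z α‖ ^ 2 ∂P) * ∫ α, weightDensity ρ n (z α) ∂P := by
  have hG := continuous_weightDensity ρ n
  have h1 := h.two_mul_integral_weight_inner (w := fun x => ‖x‖ ^ 2 * weightDensity ρ n x)
    (by fun_prop) hG
  have hi : ∀ f g : Plane → ℝ, Continuous f → Continuous g →
      Integrable (fun p : S × S => f (z p.1) * g (z p.2)) (P.prod P) := fun f g hf hg =>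
    h.integrable_prod_comp (f := fun x y => f x * g y) (by fun_prop)
  have hi1 := hi _ (fun x => ‖x‖ ^ 2) hG (by fun_prop)
  have hi2 := hi (fun x => ‖x‖ ^ 2) _ (by fun_prop) hG
  have h2 : |2 * ∫ α, ‖z α‖ ^ 2 * weightDensity ρ n (z α)
      * inner ℝ (z α) (selfVelocity P z (z α)) ∂P|
      ≤ ∫ p : S × S, (8 * n + 20) * (weightDensity ρ n (z p.1) * ‖z p.2‖ ^ 2
        + ‖z p.1‖ ^ 2 * weightDensity ρ n (z p.2)) ∂(P.prod P) := by
    rw [h1, abs_neg, ← Real.norm_eq_abs]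
    refine norm_integral_le_of_norm_le ((hi1.add hi2).const_mul _) (ae_of_all _ fun p => ?_)
    refine (abs_symm_interaction_le hn (z p.1) (z p.2)).trans (le_of_eq ?_)
    ring
  rw [integral_const_mul, integral_add hi1 hi2,
    integral_prod_mul (fun α => weightDensity ρ n (z α)) (fun α => ‖z α‖ ^ 2),
    integral_prod_mul (fun α => ‖z α‖ ^ 2) (fun α => weightDensity ρ n (z α)),
    abs_mul, abs_two] at h2
  linarith

/-- The radial velocity at `x`: the bulk of the cloud acts only through its second moment, and
the part of the cloud outside `|z| ≤ |x| / 2` through its mass. -/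
lemma abs_inner_selfVelocity_le (h : CenteredCloud P z q σ) {x : Plane} (hx : x ≠ 0)
    {s : ℝ} (hs : 0 < s) :
    |inner ℝ x (selfVelocity P z x)| ≤ 12 * (∫ α, ‖z α‖ ^ 2 ∂P) / ‖x‖ ^ 2
      + ‖x‖ * (P.real {α | ‖x‖ / 2 < ‖z α‖} / s + q * s ^ σ) := by
  have hz := h.measurable
  have hcp := continuous_perp
  have hq := h.nonneg
  have hi1 : Integrable (fun β => inner ℝ x (kernel (x - z β))) P :=
    (h.integrable_kernel x).const_inner x
  have hi2 : Integrable (fun β => inner ℝ x (perp (z β)) / ‖x‖ ^ 2) P :=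
    h.integrable_comp (f := fun y => inner ℝ x (perp y) / ‖x‖ ^ 2) (by fun_prop)
  have h0 : ∫ β, inner ℝ x (perp (z β)) / ‖x‖ ^ 2 ∂P = 0 := by
    have hp : ∫ β, perp (z β) ∂P = 0 := by
      have := perpL.integral_comp_comm (h.integrable_comp continuous_id)
      simp only [id, perpL_apply] at this
      rw [this, h.mean, ← perpL_apply, map_zero]
    rw [integral_div, integral_inner (h.integrable_comp hcp), hp, inner_zero_right, zero_div]
  have h1 : inner ℝ x (selfVelocity P z x)
      = ∫ β, (inner ℝ x (kernel (x - z β)) + inner ℝ x (perp (z β)) / ‖x‖ ^ 2) ∂P := by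
    rw [integral_add hi1 hi2, h0, add_zero, integral_inner (h.integrable_kernel x)]
    rfl
  set E := {α | ‖x‖ / 2 < ‖z α‖} with hE
  set N := {β | ‖x - z β‖ < s} with hN
  have hEm : MeasurableSet E := by measurability
  have hNm : MeasurableSet N := by measurability
  have hi3 : Integrable (fun β => ‖z β‖ ^ 2) P :=
    h.integrable_comp (f := fun y => ‖y‖ ^ 2) (by fun_prop)
  have hi4 : Integrable (E.indicator (fun _ => 1 / s)) P := (integrable_const _).indicator hEm
  have hi5 : Integrable (N.indicator (fun β => 1 / ‖x - z β‖)) P :=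
    (h.integrable_inv x).indicator hNm
  have h2 : |inner ℝ x (selfVelocity P z x)| ≤ ∫ β, (12 / ‖x‖ ^ 2 * ‖z β‖ ^ 2
      + ‖x‖ * (E.indicator (fun _ => 1 / s) β + N.indicator (fun β => 1 / ‖x - z β‖) β)) ∂P := by
    rw [h1, ← Real.norm_eq_abs]
    refine norm_integral_le_of_norm_le
      ((hi3.const_mul _).add ((hi4.add hi5).const_mul _)) (ae_of_all _ fun β => ?_)
    have e : ‖inner ℝ x (kernel (x - z β)) + inner ℝ x (perp (z β)) / ‖x‖ ^ 2‖
        = |inner ℝ x (perp (z β)) / ‖x - z β‖ ^ 2 - inner ℝ x (perp (z β)) / ‖x‖ ^ 2| := by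
      rw [inner_kernel, Real.norm_eq_abs, ← abs_neg]; congr 1; ring
    rw [e]
    have hN0 : 0 ≤ N.indicator (fun β => 1 / ‖x - z β‖) β :=
      indicator_nonneg (fun _ _ => by positivity) _
    have hE0 : 0 ≤ E.indicator (fun _ => 1 / s) β :=
      indicator_nonneg (fun _ _ => by positivity) _
    rcases le_or_gt ‖z β‖ (‖x‖ / 2) with hβ | hβ
    · refine (abs_radial_kernel_far hx hβ).trans ?_
      have : 0 ≤ ‖x‖ * (E.indicator (fun _ => 1 / s) β
        + N.indicator (fun β => 1 / ‖x - z β‖) β) := by positivity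
      have e2 : 12 * ‖z β‖ ^ 2 / ‖x‖ ^ 2 = 12 / ‖x‖ ^ 2 * ‖z β‖ ^ 2 := by ring
      linarith
    · refine (abs_radial_kernel_near hx hβ).trans ?_
      have e2 : 12 * ‖z β‖ ^ 2 / ‖x‖ ^ 2 = 12 / ‖x‖ ^ 2 * ‖z β‖ ^ 2 := by ring
      rw [e2]
      gcongr
      rcases lt_or_ge ‖x - z β‖ s with hl | hl
      · rw [indicator_of_mem (show β ∈ N from hl)]
        linarith
      · rw [indicator_of_mem (show β ∈ E from hβ)]
        have : 1 / ‖x - z β‖ ≤ 1 / s := one_div_le_one_div_of_le hs hl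
        linarith
  have h5 : ∫ β, N.indicator (fun β => 1 / ‖x - z β‖) β ∂P ≤ q * s ^ σ := by
    rw [integral_indicator hNm,
      integral_eq_lintegral_of_nonneg_ae (ae_of_all _ fun β => by positivity)
      (h.integrable_inv x).aestronglyMeasurable.restrict]
    exact ENNReal.toReal_le_of_le_ofReal (by positivity) (h.spread x s hs)
  have h4 : ∫ β, E.indicator (fun _ => 1 / s) β ∂P = P.real E / s := by
    rw [integral_indicator_const _ hEm, smul_eq_mul]; ring
  have e6 : ∫ β, (12 / ‖x‖ ^ 2 * ‖z β‖ ^ 2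
      + ‖x‖ * (E.indicator (fun _ => 1 / s) β + N.indicator (fun β => 1 / ‖x - z β‖) β)) ∂P
      = 12 / ‖x‖ ^ 2 * (∫ β, ‖z β‖ ^ 2 ∂P) + ‖x‖ * (P.real E / s
        + ∫ β, N.indicator (fun β => 1 / ‖x - z β‖) β ∂P) := by
    have hA : Integrable (fun β => E.indicator (fun _ => 1 / s) β
      + N.indicator (fun β => 1 / ‖x - z β‖) β) P := hi4.add hi5
    rw [integral_add (hi3.const_mul _) (hA.const_mul _), integral_const_mul,
      integral_const_mul, integral_add hi4 hi5, h4]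
  rw [e6] at h2
  refine h2.trans ?_
  have e7 : 12 * (∫ α, ‖z α‖ ^ 2 ∂P) / ‖x‖ ^ 2 = 12 / ‖x‖ ^ 2 * ∫ α, ‖z α‖ ^ 2 ∂P := by ring
  rw [e7]
  gcongr

lemma measureReal_lt_norm_le (h : CenteredCloud P z q σ) (ρ : ℝ) (n : ℕ) {R : ℝ} (hR : 0 < R) :
    P.real {α | R < ‖z α‖} ≤ (∫ α, (ρ ^ 4 + ‖z α‖ ^ 4) ^ n ∂P) / R ^ (4 * n) := by
  have hi : Integrable (fun α => (ρ ^ 4 + ‖z α‖ ^ 4) ^ n) P :=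
    h.integrable_comp (f := fun y => (ρ ^ 4 + ‖y‖ ^ 4) ^ n) (by fun_prop)
  have h1 := mul_meas_ge_le_integral_of_nonneg
    (ae_of_all P fun α => (by positivity : 0 ≤ (ρ ^ 4 + ‖z α‖ ^ 4) ^ n)) hi (R ^ (4 * n))
  rw [le_div_iff₀ (by positivity), mul_comm]
  refine le_trans (mul_le_mul_of_nonneg_left ?_ (by positivity)) h1
  refine measureReal_mono (fun α hα => ?_) (measure_ne_top _ _)
  simp only [mem_ofPred_eq] at hα ⊢
  rw [pow_mul]
  gcongr
  have : R ^ 4 ≤ ‖z α‖ ^ 4 := by gcongr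
  nlinarith [sq_nonneg (ρ ^ 2)]

end CenteredCloud

/-! ### Differential inequalities -/

/-- Gronwall's inequality with the derivative required at interior times only. -/
lemma le_mul_exp_of_deriv_le {f f' : ℝ → ℝ} {K T : ℝ} (hf : ContinuousOn f (Icc 0 T))
    (hf' : ∀ t ∈ Ioo 0 T, HasDerivAt f (f' t) t) (hK : ∀ t ∈ Ioo 0 T, f' t ≤ K * f t) :
    ∀ t ∈ Icc 0 T, f t ≤ f 0 * Real.exp (K * t) := by
  intro t ht
  have hT : 0 ≤ T := ht.1.trans ht.2
  have hd : ∀ s ∈ Ioo 0 T, HasDerivAt (fun s => f s * Real.exp (-(K * s)))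
      (f' s * Real.exp (-(K * s)) + f s * (Real.exp (-(K * s)) * (-(K * 1)))) s := fun s hs =>
    (hf' s hs).mul (((hasDerivAt_id s).const_mul K).neg.exp)
  have hanti : AntitoneOn (fun s => f s * Real.exp (-(K * s))) (Icc 0 T) := by
    refine antitoneOn_of_deriv_nonpos (convex_Icc 0 T)
      (hf.mul (by fun_prop : Continuous fun s => Real.exp (-(K * s))).continuousOn) ?_ ?_
    · intro s hs
      rw [interior_Icc] at hs
      exact (hd s hs).differentiableAt.differentiableWithinAt
    · intro s hs
      rw [interior_Icc] at hs
      rw [(hd s hs).deriv]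
      have := hK s hs
      have he := Real.exp_pos (-(K * s))
      nlinarith
  have h1 := hanti (left_mem_Icc.2 hT) ht ht.1
  simp only [mul_zero, neg_zero, Real.exp_zero, mul_one] at h1
  calc f t = f t * Real.exp (-(K * t)) * Real.exp (K * t) := by
        rw [mul_assoc, ← Real.exp_add]; simp
    _ ≤ _ := by gcongr

/-- A continuous function that starts strictly below a barrier and grows strictly more slowly than
the barrier whenever they meet stays below it. -/
lemma le_barrier {f f' b b' : ℝ → ℝ} {T : ℝ} (hf : ContinuousOn f (Icc 0 T))
    (hf' : ∀ t ∈ Ioo 0 T, HasDerivAt f (f' t) t) (hb : ∀ t, HasDerivAt b (b' t) t)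
    (h0 : f 0 < b 0) (hlt : ∀ t ∈ Ioo 0 T, f t = b t → f' t < b' t) :
    ∀ t ∈ Icc 0 T, f t ≤ b t := by
  intro t ht
  rcases ht.1.eq_or_lt with rfl | ht0
  · exact h0.le
  have hbc : Continuous b := continuous_iff_continuousAt.2 fun s => (hb s).continuousAt
  have hT : 0 < T := ht0.trans_le ht.2
  -- the derivative at time `0` is not available, so the comparison starts at a small `δ > 0`
  have hev : ∀ᶠ δ in 𝓝[>] (0 : ℝ), f δ < b δ := by
    have h1 : ContinuousWithinAt f (Ioi 0) 0 :=
      (hf 0 (left_mem_Icc.2 hT.le)).mono_of_mem_nhdsWithin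
        (mem_of_superset (Ioc_mem_nhdsGT hT) Ioc_subset_Icc_self)
    exact h1.eventually_lt hbc.continuousAt.continuousWithinAt h0
  obtain ⟨δ, hδ, hδ'⟩ := (hev.and (Ioo_mem_nhdsGT ht0)).exists
  refine image_le_of_deriv_right_lt_deriv_boundary (a := δ) (b := t) (f := f) (f' := f')
    (hf.mono (Icc_subset_Icc hδ'.1.le ht.2)) (fun s hs => ?_) hδ.le hb (fun s hs => ?_)
    (right_mem_Icc.2 hδ'.2.le)
  · exact (hf' s ⟨hδ'.1.trans_le hs.1, hs.2.trans_le ht.2⟩).hasDerivWithinAt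
  · exact hlt s ⟨hδ'.1.trans_le hs.1, hs.2.trans_le ht.2⟩

/-! ### Averages along a flow -/

/-- A family `Z t α` of paths labelled by `α ∈ B`, where `B` has full measure, that is bounded and
Lipschitz on `[0, T]` uniformly in `α`, with velocity `V t α`. No regularity of `V` in `t` is
assumed. -/
structure IsLipschitzFlow {S : Type*} [MeasurableSpace S] (P : Measure S) (B : Set S) (T : ℝ)
    (Z V : ℝ → S → Plane) : Prop where
  ae_mem : ∀ᵐ α ∂P, α ∈ B
  measurable : ∀ t ∈ Icc 0 T, Measurable (Z t)
  bounded : ∃ D : ℝ, ∀ α ∈ B, ∀ t ∈ Icc 0 T, ‖Z t α‖ ≤ D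
  lipschitz : ∃ Λ : ℝ≥0, ∀ α ∈ B, LipschitzOnWith Λ (fun t => Z t α) (Icc 0 T)
  deriv : ∀ α ∈ B, ∀ t ∈ Ioo 0 T, HasDerivAt (fun s => Z s α) (V t α) t

/-- A pointwise time derivative of measurable functions is measurable, as a limit of difference
quotients. -/
lemma aestronglyMeasurable_of_hasDerivAt {S F : Type*} [MeasurableSpace S] {P : Measure S}
    [NormedAddCommGroup F] [NormedSpace ℝ F] {T t : ℝ} (ht : t ∈ Ioo 0 T) {f : ℝ → S → F}
    {f' : S → F} (hf : ∀ s ∈ Icc 0 T, AEStronglyMeasurable (f s) P)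
    (hd : ∀ᵐ α ∂P, HasDerivAt (fun s => f s α) (f' α) t) : AEStronglyMeasurable f' P := by
  set h : ℕ → ℝ := fun k => t + (T - t) / (k + 2) with hh
  have hpos : ∀ k : ℕ, 0 < (T - t) / (k + 2) := fun k =>
    div_pos (by linarith [ht.2]) (by positivity)
  have hmem : ∀ k, h k ∈ Icc 0 T := fun k => by
    refine ⟨by simp only [hh]; linarith [hpos k, ht.1], ?_⟩
    have : (T - t) / (k + 2) ≤ T - t :=
      div_le_self (by linarith [ht.2]) (by linarith [k.cast_nonneg (α := ℝ)])
    simp only [hh]; linarith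
  have hlim : Tendsto h atTop (𝓝[≠] t) := by
    refine tendsto_nhdsWithin_iff.2 ⟨?_, Eventually.of_forall fun k => ?_⟩
    · have h1 : Tendsto (fun k : ℕ => (T - t) / ((k : ℝ) + 2)) atTop (𝓝 0) :=
        tendsto_const_nhds.div_atTop
          (tendsto_atTop_add_const_right _ _ tendsto_natCast_atTop_atTop)
      simpa [hh] using h1.const_add t
    · simp only [hh, mem_compl_iff, mem_singleton_iff]
      linarith [hpos k]
  refine aestronglyMeasurable_of_tendsto_ae atTop
    (f := fun (k : ℕ) α => (h k - t)⁻¹ • (f (h k) α - f t α)) (fun k => ?_) ?_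
  · exact ((hf _ (hmem k)).sub (hf t (Ioo_subset_Icc_self ht))).const_smul _
  · filter_upwards [hd] with α hα
    exact (hasDerivAt_iff_tendsto_slope.1 hα).comp hlim

namespace IsLipschitzFlow

variable {S : Type*} [MeasurableSpace S] {P : Measure S}
  {B : Set S} {T : ℝ} {Z V : ℝ → S → Plane} {F : Type*} [NormedAddCommGroup F] {φ : Plane → F}

lemma exists_lipschitz_comp [NormedSpace ℝ F] (h : IsLipschitzFlow P B T Z V)
    (hφ : ContDiff ℝ 1 φ) :
    ∃ Λ : ℝ≥0, ∀ α ∈ B, LipschitzOnWith Λ (fun t => φ (Z t α)) (Icc 0 T) := by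
  obtain ⟨D, hD⟩ := h.bounded
  obtain ⟨Λ, hΛ⟩ := h.lipschitz
  obtain ⟨C, hC⟩ := (isCompact_closedBall (0 : Plane) D).exists_bound_of_continuousOn
    (hφ.continuous_fderiv one_ne_zero).continuousOn
  have hL : LipschitzOnWith C.toNNReal φ (Metric.closedBall 0 D) :=
    Convex.lipschitzOnWith_of_nnnorm_fderiv_le (𝕜 := ℝ)
      (fun x _ => (hφ.differentiable one_ne_zero) x)
      (fun x hx => by
        rw [← NNReal.coe_le_coe, coe_nnnorm]
        exact (hC x hx).trans (Real.le_coe_toNNReal C)) (convex_closedBall _ _)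
  refine ⟨C.toNNReal * Λ, fun α hα => hL.comp (hΛ α hα) fun t ht => ?_⟩
  simpa using hD α hα t ht

lemma integrable_comp [IsProbabilityMeasure P] (h : IsLipschitzFlow P B T Z V)
    (hφ : Continuous φ) {t : ℝ} (ht : t ∈ Icc 0 T) : Integrable (fun α => φ (Z t α)) P := by
  obtain ⟨D, hD⟩ := h.bounded
  obtain ⟨C, hC⟩ := (isCompact_closedBall (0 : Plane) D).exists_bound_of_continuousOn
    hφ.continuousOn
  refine Integrable.of_bound (hφ.comp_aestronglyMeasurable
    (h.measurable t ht).aestronglyMeasurable) C ?_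
  filter_upwards [h.ae_mem] with α hα
  exact hC _ (by simpa using hD α hα t ht)

lemma exists_lipschitz_integral [IsProbabilityMeasure P] [NormedSpace ℝ F]
    (h : IsLipschitzFlow P B T Z V) (hφ : ContDiff ℝ 1 φ) :
    ∃ Λ : ℝ≥0, LipschitzOnWith Λ (fun t => ∫ α, φ (Z t α) ∂P) (Icc 0 T) := by
  obtain ⟨Λ, hΛ⟩ := h.exists_lipschitz_comp hφ
  refine ⟨Λ, LipschitzOnWith.of_dist_le_mul fun t ht s hs => ?_⟩
  rw [dist_eq_norm, ← integral_sub (h.integrable_comp hφ.continuous ht)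
    (h.integrable_comp hφ.continuous hs)]
  refine (norm_integral_le_of_norm_le_const (C := Λ * dist t s) ?_).trans (by simp)
  filter_upwards [h.ae_mem] with α hα
  rw [← dist_eq_norm]
  exact (hΛ α hα).dist_le_mul t ht s hs

lemma hasDerivAt_integral [IsProbabilityMeasure P] [NormedSpace ℝ F]
    (h : IsLipschitzFlow P B T Z V) (hφ : ContDiff ℝ 1 φ) {t : ℝ} (ht : t ∈ Ioo 0 T) :
    Integrable (fun α => fderiv ℝ φ (Z t α) (V t α)) P ∧
    HasDerivAt (fun t => ∫ α, φ (Z t α) ∂P) (∫ α, fderiv ℝ φ (Z t α) (V t α) ∂P) t := by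
  obtain ⟨Λ, hΛ⟩ := h.exists_lipschitz_comp hφ
  have hd : ∀ᵐ α ∂P, HasDerivAt (fun s => φ (Z s α)) (fderiv ℝ φ (Z t α) (V t α)) t := by
    filter_upwards [h.ae_mem] with α hα
    exact ((hφ.differentiable one_ne_zero) (Z t α)).hasFDerivAt.comp_hasDerivAt t
      (h.deriv α hα t ht)
  have hm : ∀ s ∈ Icc 0 T, AEStronglyMeasurable (fun α => φ (Z s α)) P := fun s hs =>
    (h.integrable_comp hφ.continuous hs).aestronglyMeasurable
  have hnhds : Icc 0 T ∈ 𝓝 t := Icc_mem_nhds ht.1 ht.2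
  refine hasDerivAt_integral_of_dominated_loc_of_lip (bound := fun _ => (Λ : ℝ)) hnhds
    (by filter_upwards [hnhds] with s hs using hm s hs)
    (h.integrable_comp hφ.continuous (Ioo_subset_Icc_self ht))
    (aestronglyMeasurable_of_hasDerivAt ht hm hd) ?_ (integrable_const _) hd
  filter_upwards [h.ae_mem] with α hα
  simpa using hΛ α hα

lemma integrable_velocity [IsProbabilityMeasure P] (h : IsLipschitzFlow P B T Z V) {t : ℝ}
    (ht : t ∈ Ioo 0 T) : Integrable (V t) P := by
  simpa using (h.hasDerivAt_integral (φ := id) contDiff_id ht).1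

/-- Passing to the frame of the mean position. -/
lemma centered [IsProbabilityMeasure P] (h : IsLipschitzFlow P B T Z V) :
    IsLipschitzFlow P B T (fun t α => Z t α - ∫ β, Z t β ∂P)
      (fun t α => V t α - ∫ β, V t β ∂P) where
  ae_mem := h.ae_mem
  measurable t ht := (h.measurable t ht).sub_const _
  bounded := by
    obtain ⟨D, hD⟩ := h.bounded
    refine ⟨D + D, fun α hα t ht => (norm_sub_le _ _).trans (add_le_add (hD α hα t ht) ?_)⟩
    refine (norm_integral_le_of_norm_le_const (C := D) ?_).trans (by simp)
    filter_upwards [h.ae_mem] with β hβ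
    exact hD β hβ t ht
  lipschitz := by
    obtain ⟨Λ, hΛ⟩ := h.lipschitz
    obtain ⟨Λ', hΛ'⟩ := h.exists_lipschitz_integral (φ := id) contDiff_id
    exact ⟨Λ + Λ', fun α hα => (hΛ α hα).sub hΛ'⟩
  deriv α hα t ht := by
    have h1 := (h.hasDerivAt_integral (φ := id) contDiff_id ht).2
    simp only [id, fderiv_id, ContinuousLinearMap.id_apply] at h1
    exact (h.deriv α hα t ht).sub h1

end IsLipschitzFlow

/-! ### Moments and trajectories of a centred vortex -/

/-- A vortex of circulation `2πκ`, seen from its centre: `P` is the normalised initial vorticity,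
`Z t α` is the position relative to the centre at time `t` of the particle labelled `α`, and
`W t α` is the external velocity relative to that of the centre. The external field is `L`-Lipschitz
up to an error `δ`, and initially the vortex has diameter at most `2δ`. -/
structure IsCenteredVortex {S : Type*} [MeasurableSpace S] (P : Measure S) (B : Set S)
    (T : ℝ) (Z W : ℝ → S → Plane) (κ q σ L δ : ℝ) : Prop where
  flow : IsLipschitzFlow P B T Z (fun t α => κ • selfVelocity P (Z t) (Z t α) + W t α)
  cloud : ∀ t ∈ Icc 0 T, CenteredCloud P (Z t) q σ
  external : ∀ α ∈ B, ∀ t ∈ Ioo 0 T,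
    ‖W t α‖ ≤ L * ‖Z t α‖ + L * (∫ β, ‖Z t β‖ ∂P) + 2 * δ
  initial : ∀ α ∈ B, ‖Z 0 α‖ ≤ 2 * δ

lemma hasFDerivAt_weight (ρ : ℝ) (n : ℕ) (z : Plane) :
    HasFDerivAt (fun y : Plane => (ρ ^ 4 + ‖y‖ ^ 4) ^ n)
      ((‖z‖ ^ 2 * weightDensity ρ n z) • innerSL ℝ z) z := by
  have h1 : HasFDerivAt (fun y : Plane => ‖y‖ ^ 2) (2 • innerSL ℝ z) z :=
    (hasStrictFDerivAt_norm_sq z).hasFDerivAt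
  have h2 : HasDerivAt (fun u : ℝ => (ρ ^ 4 + u ^ 2) ^ n)
      (n * (ρ ^ 4 + (‖z‖ ^ 2) ^ 2) ^ (n - 1) * (2 * ‖z‖ ^ 2)) (‖z‖ ^ 2) := by
    simpa using (((hasDerivAt_id' (‖z‖ ^ 2)).fun_pow 2).const_add (ρ ^ 4)).fun_pow n
  have e : (fun y : Plane => (ρ ^ 4 + ‖y‖ ^ 4) ^ n)
      = (fun u : ℝ => (ρ ^ 4 + u ^ 2) ^ n) ∘ fun y : Plane => ‖y‖ ^ 2 := by
    ext y; simp only [Function.comp]; ring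
  rw [e]
  refine (h2.comp_hasFDerivAt z h1).congr_fderiv ?_
  ext v
  simp only [weightDensity, two_smul, smul_apply, add_apply,
    innerSL_apply_apply, smul_eq_mul]
  ring

lemma contDiff_weight (ρ : ℝ) (n : ℕ) :
    ContDiff ℝ 1 (fun y : Plane => (ρ ^ 4 + ‖y‖ ^ 4) ^ n) := by
  have e : (fun y : Plane => (ρ ^ 4 + ‖y‖ ^ 4) ^ n)
      = fun y : Plane => (ρ ^ 4 + (‖y‖ ^ 2) ^ 2) ^ n := by
    ext y; ring
  rw [e]
  exact (contDiff_const.add ((contDiff_norm_sq ℝ).pow 2)).pow n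

namespace IsCenteredVortex

variable {S : Type*} [MeasurableSpace S] {P : Measure S} [IsProbabilityMeasure P]
  {B : Set S} {T : ℝ} {Z W : ℝ → S → Plane} {κ q σ L δ : ℝ}

lemma sq_integral_norm_le (h : IsCenteredVortex P B T Z W κ q σ L δ) {t : ℝ}
    (ht : t ∈ Icc 0 T) : (∫ β, ‖Z t β‖ ∂P) ^ 2 ≤ ∫ β, ‖Z t β‖ ^ 2 ∂P := by
  have hc := h.cloud t ht
  set m := ∫ β, ‖Z t β‖ ∂P with hm
  have i1 : Integrable (fun β => ‖Z t β‖) P := hc.integrable_comp continuous_norm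
  have i2 : Integrable (fun β => ‖Z t β‖ ^ 2) P :=
    hc.integrable_comp (f := fun y => ‖y‖ ^ 2) (by fun_prop)
  have h0 : 0 ≤ ∫ β, (‖Z t β‖ - m) ^ 2 ∂P := integral_nonneg fun β => sq_nonneg _
  have e : ∀ β, (‖Z t β‖ - m) ^ 2 = ‖Z t β‖ ^ 2 - 2 * m * ‖Z t β‖ + m ^ 2 := fun β => by ring
  have i3 : Integrable (fun β => ‖Z t β‖ ^ 2 - 2 * m * ‖Z t β‖) P := i2.sub (i1.const_mul _)
  simp only [e] at h0
  rw [integral_add i3 (integrable_const _), integral_sub i2 (i1.const_mul _),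
    integral_const_mul, ← hm] at h0
  simp at h0
  linarith

/-- Evolution of the average of a radial function with gradient `w(z) z`: the self-interaction and
the external field are separated. -/
lemma exists_hasDerivAt_radial (h : IsCenteredVortex P B T Z W κ q σ L δ) {φ w : Plane → ℝ}
    (hφ : ContDiff ℝ 1 φ) (hw : Continuous w) (hw0 : ∀ z, 0 ≤ w z)
    (hφw : ∀ z, HasFDerivAt φ (w z • innerSL ℝ z) z) {t : ℝ} (ht : t ∈ Ioo 0 T) :
    ∃ d : ℝ, HasDerivAt (fun t => ∫ α, φ (Z t α) ∂P) d t ∧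
      d ≤ |κ| * |∫ α, w (Z t α) * inner ℝ (Z t α) (selfVelocity P (Z t) (Z t α)) ∂P|
        + ∫ α, w (Z t α) * ‖Z t α‖
          * (L * ‖Z t α‖ + L * (∫ β, ‖Z t β‖ ∂P) + 2 * δ) ∂P := by
  have ht' := Ioo_subset_Icc_self ht
  have hc := h.cloud t ht'
  obtain ⟨hi, hd⟩ := h.flow.hasDerivAt_integral hφ ht
  refine ⟨_, hd, ?_⟩
  have e : ∀ α, fderiv ℝ φ (Z t α) (κ • selfVelocity P (Z t) (Z t α) + W t α)
      = κ * (w (Z t α) * inner ℝ (Z t α) (selfVelocity P (Z t) (Z t α)))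
        + w (Z t α) * inner ℝ (Z t α) (W t α) := fun α => by
    rw [(hφw _).fderiv]
    simp [inner_add_right, inner_smul_right]
    ring
  simp only [e] at hi ⊢
  have i1 : Integrable (fun α => w (Z t α) *
      inner ℝ (Z t α) (selfVelocity P (Z t) (Z t α))) P := by
    have hm : AEStronglyMeasurable (fun α => w (Z t α) *
        inner ℝ (Z t α) (selfVelocity P (Z t) (Z t α))) P :=
      (hw.comp_aestronglyMeasurable hc.measurable.aestronglyMeasurable).mul
        (hc.measurable.aestronglyMeasurable.inner
          hc.measurable_selfVelocity_comp.aestronglyMeasurable)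
    have i0 : Integrable (fun α => w (Z t α) * ‖Z t α‖ * (q + 1)) P :=
      hc.integrable_comp (f := fun z => w z * ‖z‖ * (q + 1)) (by fun_prop)
    refine i0.mono' hm (ae_of_all _ fun α => ?_)
    rw [norm_mul, Real.norm_of_nonneg (hw0 _), mul_assoc]
    refine mul_le_mul_of_nonneg_left ?_ (hw0 _)
    refine (norm_inner_le_norm _ _).trans ?_
    gcongr
    exact hc.norm_selfVelocity_le _
  have i2 : Integrable (fun α => w (Z t α) * inner ℝ (Z t α) (W t α)) P := by
    refine (hi.sub (i1.const_mul κ)).congr (ae_of_all _ fun α => ?_)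
    simp
  have i3 : Integrable (fun α => w (Z t α) * ‖Z t α‖
      * (L * ‖Z t α‖ + L * (∫ β, ‖Z t β‖ ∂P) + 2 * δ)) P :=
    hc.integrable_comp
      (f := fun z => w z * ‖z‖ * (L * ‖z‖ + L * (∫ β, ‖Z t β‖ ∂P) + 2 * δ)) (by fun_prop)
  rw [integral_add (i1.const_mul κ) i2, integral_const_mul]
  refine add_le_add ((le_abs_self _).trans (abs_mul _ _).le) (integral_mono_ae i2 i3 ?_)
  filter_upwards [h.flow.ae_mem] with α hα
  rw [mul_assoc]
  refine mul_le_mul_of_nonneg_left ((real_inner_le_norm _ _).trans ?_) (hw0 _)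
  gcongr
  exact h.external α hα t ht

lemma continuousOn_integral (h : IsCenteredVortex P B T Z W κ q σ L δ) {φ : Plane → ℝ}
    (hφ : ContDiff ℝ 1 φ) : ContinuousOn (fun t => ∫ α, φ (Z t α) ∂P) (Icc 0 T) :=
  (h.flow.exists_lipschitz_integral hφ).choose_spec.continuousOn

/-- The second moment feels only the external field. -/
lemma second_moment_le (h : IsCenteredVortex P B T Z W κ q σ L δ) (hL : 0 ≤ L) {t : ℝ}
    (ht : t ∈ Icc 0 T) :
    ∫ α, ‖Z t α‖ ^ 2 ∂P ≤ 5 * δ ^ 2 * Real.exp ((4 * L + 2) * t) := by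
  have hφ : ContDiff ℝ 1 (fun z : Plane => ‖z‖ ^ 2) := contDiff_norm_sq ℝ
  have h1 : ∀ t, ∃ d : ℝ, t ∈ Ioo 0 T → HasDerivAt (fun t => ∫ α, ‖Z t α‖ ^ 2 ∂P + δ ^ 2) d t ∧
      d ≤ (4 * L + 2) * (∫ α, ‖Z t α‖ ^ 2 ∂P + δ ^ 2) := by
    intro t
    by_cases ht : t ∈ Ioo 0 T
    swap
    · exact ⟨0, fun h' => absurd h' ht⟩
    have ht' := Ioo_subset_Icc_self ht
    have hc := h.cloud t ht'
    obtain ⟨d, hd, hle⟩ := h.exists_hasDerivAt_radial (w := fun _ => 2) hφ continuous_const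
      (fun _ => by norm_num) (fun z =>
        (hasStrictFDerivAt_norm_sq z).hasFDerivAt.congr_fderiv (by simp only [two_smul])) ht
    refine ⟨d, fun _ => ⟨hd.add_const _, hle.trans ?_⟩⟩
    rw [integral_const_mul, hc.integral_inner_selfVelocity]
    set m := ∫ β, ‖Z t β‖ ∂P with hm
    have hm2 := h.sq_integral_norm_le ht'
    have i1 : Integrable (fun β => ‖Z t β‖) P := hc.integrable_comp continuous_norm
    have i2 : Integrable (fun β => ‖Z t β‖ ^ 2) P :=
      hc.integrable_comp (f := fun y => ‖y‖ ^ 2) (by fun_prop)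
    have e : ∀ α, 2 * ‖Z t α‖ * (L * ‖Z t α‖ + L * m + 2 * δ)
        = 2 * L * ‖Z t α‖ ^ 2 + (2 * (L * m + 2 * δ)) * ‖Z t α‖ := fun α => by ring
    simp only [e]
    rw [integral_add (i2.const_mul _) (i1.const_mul _), integral_const_mul, integral_const_mul,
      ← hm]
    rw [← hm] at hm2
    have h3 : L * m ^ 2 ≤ L * ∫ β, ‖Z t β‖ ^ 2 ∂P := by gcongr
    have h4 : 2 * δ * m ≤ δ ^ 2 + m ^ 2 := by nlinarith [sq_nonneg (δ - m)]
    have h5 : 0 ≤ L * δ ^ 2 := by positivity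
    simp only [mul_zero, abs_zero, zero_add]
    nlinarith
  choose d hd using h1
  have h2 := le_mul_exp_of_deriv_le (K := 4 * L + 2)
    (f := fun t => ∫ α, ‖Z t α‖ ^ 2 ∂P + δ ^ 2)
    ((h.continuousOn_integral hφ).add continuousOn_const) (fun t ht => (hd t ht).1)
    (fun t ht => (hd t ht).2) t ht
  have h0 : ∫ α, ‖Z 0 α‖ ^ 2 ∂P ≤ 4 * δ ^ 2 := by
    have h0T : (0 : ℝ) ∈ Icc 0 T := left_mem_Icc.2 (ht.1.trans ht.2)
    calc _ ≤ ∫ _, 4 * δ ^ 2 ∂P := by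
          refine integral_mono_ae ((h.cloud 0 h0T).integrable_comp
            (f := fun y => ‖y‖ ^ 2) (by fun_prop)) (integrable_const _) ?_
          filter_upwards [h.flow.ae_mem] with α hα
          have := pow_le_pow_left₀ (norm_nonneg _) (h.initial α hα) 2
          linarith
      _ = _ := by simp
  have he := Real.exp_pos ((4 * L + 2) * t)
  calc _ ≤ ∫ α, ‖Z t α‖ ^ 2 ∂P + δ ^ 2 := by linarith [sq_nonneg δ]
    _ ≤ _ := h2
    _ ≤ _ := by gcongr; linarith

/-- As long as the second moment is at most `ρ⁴`, the average of `(ρ⁴ + |z|⁴) ^ n` grows at a rate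
that depends on neither `ρ` nor the concentration of the vortex. -/
lemma weight_moment_le (h : IsCenteredVortex P B T Z W κ q σ L δ) (hL : 0 ≤ L) {ρ M : ℝ}
    {n : ℕ} (hn : 1 ≤ n) (hκ : |κ| ≤ M) (hρ : 0 < ρ) (hρ1 : ρ ≤ 1)
    (hδ : 2 * δ ≤ ρ) (hJ : ∀ t ∈ Icc 0 T, ∫ α, ‖Z t α‖ ^ 2 ∂P ≤ ρ ^ 4) {t : ℝ}
    (ht : t ∈ Icc 0 T) :
    ∫ α, (ρ ^ 4 + ‖Z t α‖ ^ 4) ^ n ∂P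
      ≤ (2 * ρ ^ 4) ^ n * Real.exp (4 * n * (M * (8 * n + 20) + 2 * L + 1) * t) := by
  have hφ := contDiff_weight ρ n
  have hM : 0 ≤ M := (abs_nonneg κ).trans hκ
  set K : ℝ := 4 * n * (M * (8 * n + 20) + 2 * L + 1) with hK
  have h1 : ∀ t, ∃ d : ℝ, t ∈ Ioo 0 T →
      HasDerivAt (fun t => ∫ α, (ρ ^ 4 + ‖Z t α‖ ^ 4) ^ n ∂P) d t ∧
      d ≤ K * ∫ α, (ρ ^ 4 + ‖Z t α‖ ^ 4) ^ n ∂P := by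
    intro t
    by_cases ht : t ∈ Ioo 0 T
    swap
    · exact ⟨0, fun h' => absurd h' ht⟩
    have ht' := Ioo_subset_Icc_self ht
    have hc := h.cloud t ht'
    have hG := continuous_weightDensity ρ n
    obtain ⟨d, hd, hle⟩ := h.exists_hasDerivAt_radial
      (w := fun z => ‖z‖ ^ 2 * weightDensity ρ n z) hφ (by fun_prop)
      (fun z => mul_nonneg (by positivity) (weightDensity_nonneg _ _ _))
      (hasFDerivAt_weight ρ n) ht
    refine ⟨d, fun _ => ⟨hd, hle.trans ?_⟩⟩
    set m := ∫ β, ‖Z t β‖ ∂P with hm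
    have hm0 : 0 ≤ m := integral_nonneg fun β => norm_nonneg _
    have hmρ : m ≤ ρ := by
      have h2 : m ^ 2 ≤ ρ ^ 4 := (h.sq_integral_norm_le ht').trans (hJ t ht')
      have h3 : m ≤ ρ ^ 2 := by
        refine le_of_sq_le_sq (h2.trans (by ring_nf; rfl)) (by positivity)
      nlinarith
    have ig : Integrable (fun α => (ρ ^ 4 + ‖Z t α‖ ^ 4) ^ n) P :=
      hc.integrable_comp (f := fun z => (ρ ^ 4 + ‖z‖ ^ 4) ^ n) hφ.continuous
    have iG : Integrable (fun α => weightDensity ρ n (Z t α)) P := hc.integrable_comp hG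
    have hpow : ∀ x : ℝ, x ^ n = x ^ (n - 1) * x := fun x => by
      rw [← pow_succ, Nat.sub_add_cancel hn]
    -- the self-interaction
    have hGg : ρ ^ 4 * ∫ α, weightDensity ρ n (Z t α) ∂P
        ≤ 4 * n * ∫ α, (ρ ^ 4 + ‖Z t α‖ ^ 4) ^ n ∂P := by
      rw [← integral_const_mul, ← integral_const_mul]
      refine integral_mono (iG.const_mul _) (ig.const_mul _) fun α => ?_
      simp only [weightDensity, hpow (ρ ^ 4 + ‖Z t α‖ ^ 4)]
      have : ρ ^ 4 ≤ ρ ^ 4 + ‖Z t α‖ ^ 4 := by linarith [pow_nonneg (norm_nonneg (Z t α)) 4]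
      calc _ = 4 * n * ((ρ ^ 4 + ‖Z t α‖ ^ 4) ^ (n - 1) * ρ ^ 4) := by ring
        _ ≤ _ := by gcongr
    have hself := hc.abs_integral_weight_inner_le ρ hn
    have hG0 : 0 ≤ ∫ α, weightDensity ρ n (Z t α) ∂P :=
      integral_nonneg fun α => weightDensity_nonneg _ _ _
    have hJ0 : 0 ≤ ∫ α, ‖Z t α‖ ^ 2 ∂P := integral_nonneg fun α => by positivity
    have b1 : |κ| * |∫ α, ‖Z t α‖ ^ 2 * weightDensity ρ n (Z t α)
        * inner ℝ (Z t α) (selfVelocity P (Z t) (Z t α)) ∂P|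
        ≤ M * (8 * n + 20) * (4 * n * ∫ α, (ρ ^ 4 + ‖Z t α‖ ^ 4) ^ n ∂P) := by
      calc _ ≤ M * ((8 * n + 20) * (∫ α, ‖Z t α‖ ^ 2 ∂P)
            * ∫ α, weightDensity ρ n (Z t α) ∂P) := by gcongr
        _ ≤ M * ((8 * n + 20) * ρ ^ 4 * ∫ α, weightDensity ρ n (Z t α) ∂P) := by
            gcongr; exact hJ t ht'
        _ = M * (8 * n + 20) * (ρ ^ 4 * ∫ α, weightDensity ρ n (Z t α) ∂P) := by ring
        _ ≤ _ := by gcongr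
    -- the external field
    have b2 : ∫ α, ‖Z t α‖ ^ 2 * weightDensity ρ n (Z t α) * ‖Z t α‖
        * (L * ‖Z t α‖ + L * m + 2 * δ) ∂P
        ≤ 4 * n * (2 * L + 1) * ∫ α, (ρ ^ 4 + ‖Z t α‖ ^ 4) ^ n ∂P := by
      refine le_trans ?_ (integral_const_mul _ _).le
      refine integral_mono (hc.integrable_comp (f := fun z => ‖z‖ ^ 2 * weightDensity ρ n z * ‖z‖
        * (L * ‖z‖ + L * m + 2 * δ)) (by fun_prop)) (ig.const_mul _) fun α => ?_
      simp only [weightDensity, hpow (ρ ^ 4 + ‖Z t α‖ ^ 4)]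
      set r := ‖Z t α‖ with hr
      have hr0 : 0 ≤ r := norm_nonneg _
      have q1 : r ^ 3 * r ≤ ρ ^ 4 + r ^ 4 := by nlinarith [pow_pos hρ 4]
      have q2 : r ^ 3 * ρ ≤ ρ ^ 4 + r ^ 4 := by
        rcases le_total r ρ with hrρ | hrρ
        · calc r ^ 3 * ρ ≤ ρ ^ 3 * ρ := by gcongr
            _ ≤ _ := by nlinarith [pow_nonneg hr0 4]
        · calc r ^ 3 * ρ ≤ r ^ 3 * r := by gcongr
            _ ≤ _ := q1
      calc _ = 4 * n * (ρ ^ 4 + r ^ 4) ^ (n - 1) * (r ^ 3 * (L * r + L * m + 2 * δ)) := by ring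
        _ ≤ 4 * n * (ρ ^ 4 + r ^ 4) ^ (n - 1) * (r ^ 3 * (L * r + L * ρ + ρ)) := by gcongr
        _ = 4 * n * (ρ ^ 4 + r ^ 4) ^ (n - 1) * (L * (r ^ 3 * r) + (L + 1) * (r ^ 3 * ρ)) := by
            ring
        _ ≤ 4 * n * (ρ ^ 4 + r ^ 4) ^ (n - 1)
              * (L * (ρ ^ 4 + r ^ 4) + (L + 1) * (ρ ^ 4 + r ^ 4)) := by gcongr
        _ = _ := by ring
    refine (add_le_add b1 b2).trans (le_of_eq ?_)
    rw [hK]; ring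
  choose d hd using h1
  have h2 := le_mul_exp_of_deriv_le (K := K) (h.continuousOn_integral hφ)
    (fun t ht => (hd t ht).1) (fun t ht => (hd t ht).2) t ht
  refine h2.trans ?_
  gcongr
  have h0T : (0 : ℝ) ∈ Icc 0 T := left_mem_Icc.2 (ht.1.trans ht.2)
  calc _ ≤ ∫ _, (2 * ρ ^ 4) ^ n ∂P := by
        refine integral_mono_ae ((h.cloud 0 h0T).integrable_comp
          (f := fun z => (ρ ^ 4 + ‖z‖ ^ 4) ^ n) hφ.continuous) (integrable_const _) ?_
        filter_upwards [h.flow.ae_mem] with α hα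
        have h3 : ‖Z 0 α‖ ≤ ρ := (h.initial α hα).trans hδ
        have h4 : ‖Z 0 α‖ ^ 4 ≤ ρ ^ 4 := by gcongr
        gcongr
        linarith
    _ = _ := by simp

/-- Outside a disc of radius `R` on which the second moment, the mass outside `R / 2` and the
errors are under control, a particle moves outwards at most exponentially fast. -/
lemma sq_norm_le (h : IsCenteredVortex P B T Z W κ q σ L δ) (hL : 0 ≤ L) {R M s : ℝ}
    (hκ : |κ| ≤ M) (hR : 0 < R) (hs : 0 < s) (hR1 : R ≤ 1) (hδ : 2 * δ ≤ R)
    (hJ : ∀ t ∈ Icc 0 T, ∫ α, ‖Z t α‖ ^ 2 ∂P ≤ R ^ 4)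
    (htail : ∀ t ∈ Icc 0 T, |κ| * (P.real {α | R / 2 < ‖Z t α‖} / s + q * s ^ σ) ≤ R)
    {t : ℝ} (ht : t ∈ Icc 0 T) {α : S} (hα : α ∈ B) :
    ‖Z t α‖ ^ 2 ≤ 2 * R ^ 2 * Real.exp ((24 * M + 4 * L + 5) * t) := by
  have hM : 0 ≤ M := (abs_nonneg κ).trans hκ
  obtain ⟨Λ, hΛ⟩ := h.flow.lipschitz
  set K : ℝ := 24 * M + 4 * L + 5 with hK
  have hK0 : 0 < K := by positivity
  refine le_barrier (T := T) (f := fun t => ‖Z t α‖ ^ 2)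
    (b := fun t => 2 * R ^ 2 * Real.exp (K * t)) (b' := fun t => 2 * R ^ 2 * Real.exp (K * t) * K)
    (((hΛ α hα).continuousOn.norm).pow 2)
    (fun t ht => (h.flow.deriv α hα t ht).norm_sq) (fun t => ?_) ?_ (fun t ht heq => ?_) t ht
  · have := (((hasDerivAt_id t).const_mul K).exp).const_mul (2 * R ^ 2)
    simpa [mul_assoc] using this
  · have h0 := pow_le_pow_left₀ (norm_nonneg _) ((h.initial α hα).trans hδ) 2
    simp only [mul_zero, Real.exp_zero, mul_one]
    nlinarith [pow_pos hR 2]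
  · have ht' := Ioo_subset_Icc_self ht
    have hc := h.cloud t ht'
    rw [← heq]
    set r := ‖Z t α‖ with hr
    have hr0 : 0 ≤ r := norm_nonneg _
    have hrR : R ≤ r := by
      have h1 : 1 ≤ Real.exp (K * t) := Real.one_le_exp (by have := ht.1; positivity)
      have h2 : R ^ 2 ≤ r ^ 2 := by
        rw [heq]; nlinarith [pow_pos hR 2]
      exact le_of_sq_le_sq h2 hr0
    have hrpos : 0 < r := hR.trans_le hrR
    have hne : Z t α ≠ 0 := norm_pos_iff.1 hrpos
    set m := ∫ β, ‖Z t β‖ ∂P with hm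
    have hmr : m ≤ r := by
      have h2 : m ^ 2 ≤ R ^ 4 := (h.sq_integral_norm_le ht').trans (hJ t ht')
      have h3 : m ≤ R ^ 2 := by
        refine le_of_sq_le_sq (h2.trans (by ring_nf; rfl)) (by positivity)
      nlinarith
    have hmono : P.real {β | r / 2 < ‖Z t β‖} ≤ P.real {β | R / 2 < ‖Z t β‖} := by
      refine measureReal_mono (fun β hβ => ?_) (measure_ne_top _ _)
      simp only [mem_ofPred_eq] at hβ ⊢
      linarith
    have hself : |κ| * |inner ℝ (Z t α) (selfVelocity P (Z t) (Z t α))|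
        ≤ 12 * M * r ^ 2 + r * r := by
      have h1 := hc.abs_inner_selfVelocity_le hne hs
      rw [← hr] at h1
      have h2 : 12 * (∫ β, ‖Z t β‖ ^ 2 ∂P) / r ^ 2 ≤ 12 * r ^ 2 := by
        rw [div_le_iff₀ (by positivity)]
        have : R ^ 4 ≤ r ^ 4 := by gcongr
        calc _ ≤ 12 * r ^ 4 := by linarith [hJ t ht']
          _ = _ := by ring
      have h3 : |κ| * (P.real {β | r / 2 < ‖Z t β‖} / s + q * s ^ σ) ≤ r := by
        refine le_trans (mul_le_mul_of_nonneg_left ?_ (abs_nonneg κ)) ((htail t ht').trans hrR)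
        exact add_le_add_left (div_le_div_of_nonneg_right hmono hs.le) _
      calc _ ≤ |κ| * (12 * r ^ 2 + r * (P.real {β | r / 2 < ‖Z t β‖} / s + q * s ^ σ)) :=
            mul_le_mul_of_nonneg_left (h1.trans (add_le_add_left h2 _)) (abs_nonneg κ)
        _ = |κ| * (12 * r ^ 2)
              + r * (|κ| * (P.real {β | r / 2 < ‖Z t β‖} / s + q * s ^ σ)) := by ring
        _ ≤ M * (12 * r ^ 2) + r * r := add_le_add
            (mul_le_mul_of_nonneg_right hκ (by positivity)) (mul_le_mul_of_nonneg_left h3 hr0)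
        _ = _ := by ring
    have hext : inner ℝ (Z t α) (W t α) ≤ r * (L * r + L * r + r) := by
      refine (real_inner_le_norm _ _).trans ?_
      gcongr
      refine (h.external α hα t ht).trans ?_
      gcongr
      exact hδ.trans hrR
    rw [inner_add_right, inner_smul_right]
    have hself' := (le_abs_self _).trans ((abs_mul κ
      (inner ℝ (Z t α) (selfVelocity P (Z t) (Z t α)))).le.trans hself)
    rw [hK]
    nlinarith [pow_pos hrpos 2]

end IsCenteredVortex

/-! ### Confinement on logarithmic time scales -/

lemma eventually_mul_rpow_le_one (c : ℝ) {e : ℝ} (he : 0 < e) :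
    ∀ᶠ A in 𝓝[>] (0 : ℝ), c * A ^ e ≤ 1 := by
  have h1 : Tendsto (fun A : ℝ => c * A ^ e) (𝓝[>] 0) (𝓝 0) := by
    have h2 : ContinuousAt (fun A : ℝ => c * A ^ e) 0 :=
      (Real.continuousAt_rpow_const 0 e (Or.inr he.le)).const_mul c
    have h3 := h2.tendsto
    rw [Real.zero_rpow he.ne', mul_zero] at h3
    exact h3.mono_left nhdsWithin_le_nhds
  exact (h1.eventually (gt_mem_nhds one_pos)).mono fun A h => h.le

lemma exp_mul_le_rpow_neg {A c k e t : ℝ} (hA : 0 < A) (hA1 : A ≤ 1) (hk : 0 ≤ k)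
    (hkc : k * c ≤ e) (ht : t ≤ c * |Real.log A|) : Real.exp (k * t) ≤ A ^ (-e) := by
  rw [Real.rpow_def_of_pos hA, Real.exp_le_exp]
  have hl : Real.log A ≤ 0 := Real.log_nonpos hA.le hA1
  rw [abs_of_nonpos hl] at ht
  have h1 : k * t ≤ k * (c * -Real.log A) := by gcongr
  have h2 : k * c * -Real.log A ≤ e * -Real.log A :=
    mul_le_mul_of_nonneg_right hkc (by linarith)
  linarith

/-- Choice of scales. With `η = 1 / 2 - a`, the second moment stays below `ρ⁴` for
`ρ = A ^ (a + 2η / 3)`, the mass outside the disc of radius `R / 2`, `R = A ^ (a + η / 3)`, stays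
below any prescribed power of `A`, and therefore particles starting in the disc of radius `R`
do not reach the circle of radius `A ^ a`. -/
theorem exists_forall_norm_lt {S : Type*} [MeasurableSpace S] {L C M γ σ a Q : ℝ} (hL : 0 ≤ L)
    (hM : 0 ≤ M) (hγ : 0 < γ) (hσ : 0 < σ) (ha0 : 0 < a) (ha : a < 1 / 2) :
    ∃ c₀ : ℝ, 0 < c₀ ∧ ∀ᶠ A in 𝓝[>] (0 : ℝ), ∀ (P : Measure S) [IsProbabilityMeasure P]
      (B : Set S) (Z W : ℝ → S → Plane) (κ q : ℝ),
      IsCenteredVortex P B (c₀ * |Real.log A|) Z W κ q σ L (C * A) → |κ| ≤ M →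
      |κ| * q ≤ Q * A ^ (-γ) →
      ∀ t ∈ Icc 0 (c₀ * |Real.log A|), ∀ α ∈ B, ‖Z t α‖ < A ^ a := by
  set η : ℝ := 1 / 2 - a with hη
  have hη0 : 0 < η := by linarith
  -- particles closer than `A ^ τ` to each other interact with strength `O(A)`
  set τ : ℝ := (γ + 1) / σ with hτ
  have hτ0 : 0 < τ := by positivity
  -- the mass outside the disc of radius `R / 2` is `O((ρ / R) ^ (4n) / A)`, and this has to be
  -- small compared with `A ^ (τ + 1)`
  obtain ⟨n, hn⟩ := exists_nat_gt (3 * (τ + 3) / (4 * η))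
  have hn' : τ + 3 ≤ 4 * n * η / 3 := by
    rw [div_lt_iff₀ (by positivity)] at hn; linarith
  have hn1 : 1 ≤ n := by
    rcases Nat.eq_zero_or_pos n with h | h
    · rw [h] at hn'; norm_num at hn'; linarith
    · exact h
  set K₁ : ℝ := 4 * L + 2 with hK₁
  set K₂ : ℝ := 4 * n * (M * (8 * n + 20) + 2 * L + 1) with hK₂
  set K₃ : ℝ := 24 * M + 4 * L + 5 with hK₃
  have hK₂0 : 0 ≤ K₂ := by positivity
  set K : ℝ := K₁ + K₂ + K₃ with hK
  have hK0 : 0 < K := by positivity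
  -- `c₀` is such that no exponential factor `exp (Kᵢ t)` exceeds `A ^ (-e₀)`
  set e₀ : ℝ := min (η / 3) 1 with he₀
  have he₀pos : 0 < e₀ := by positivity
  refine ⟨e₀ / K, by positivity, ?_⟩
  have hKc : ∀ k : ℝ, k ≤ K → k * (e₀ / K) ≤ e₀ := fun k hk => by
    calc k * (e₀ / K) ≤ K * (e₀ / K) := by gcongr
      _ = e₀ := by field_simp
  filter_upwards [self_mem_nhdsWithin, eventually_mul_rpow_le_one 1 one_pos,
    eventually_mul_rpow_le_one (5 * C ^ 2) hη0,
    eventually_mul_rpow_le_one (2 * C) (show 0 < 1 - (a + 2 * η / 3) by linarith),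
    eventually_mul_rpow_le_one (M * 32 ^ n + Q) (show 0 < 1 - (a + η / 3) by linarith),
    eventually_mul_rpow_le_one 4 (show 0 < η / 3 by linarith)]
    with A hA hA1 hA2 hA3 hA4 hA5 P _ B Z W κ q h hκ hQ t ht α hα
  replace hA : 0 < A := hA
  rw [one_mul, Real.rpow_one] at hA1
  set ρ : ℝ := A ^ (a + 2 * η / 3) with hρ
  set R : ℝ := A ^ (a + η / 3) with hR
  have hρ0 : 0 < ρ := Real.rpow_pos_of_pos hA _
  have hR0 : 0 < R := Real.rpow_pos_of_pos hA _
  have hρ1 : ρ ≤ 1 := Real.rpow_le_one hA.le hA1 (by linarith)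
  have hR1 : R ≤ 1 := Real.rpow_le_one hA.le hA1 (by linarith)
  have hρR : ρ ≤ R := Real.rpow_le_rpow_of_exponent_ge hA hA1 (by linarith)
  have hexp : ∀ k e s : ℝ, 0 ≤ k → k ≤ K → e₀ ≤ e → s ∈ Icc 0 (e₀ / K * |Real.log A|) →
      Real.exp (k * s) ≤ A ^ (-e) := fun k e s hk0 hk he hs =>
    exp_mul_le_rpow_neg hA hA1 hk0 ((hKc k hk).trans he) hs.2
  have hδρ : 2 * (C * A) ≤ ρ := by
    have e1 : A = A ^ (1 - (a + 2 * η / 3)) * ρ := by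
      rw [hρ, ← Real.rpow_add hA]; norm_num
    calc 2 * (C * A) = 2 * C * A ^ (1 - (a + 2 * η / 3)) * ρ := by
          conv_lhs => rw [e1]
          ring
      _ ≤ 1 * ρ := by gcongr
      _ = ρ := one_mul _
  have hJ : ∀ s ∈ Icc 0 (e₀ / K * |Real.log A|), ∫ β, ‖Z s β‖ ^ 2 ∂P ≤ ρ ^ 4 := by
    intro s hs
    refine (h.second_moment_le hL hs).trans ?_
    have e1 : A ^ 2 * A ^ (-(η / 3)) = A ^ η * ρ ^ 4 := by
      rw [hρ, ← Real.rpow_natCast, ← Real.rpow_natCast, ← Real.rpow_mul hA.le,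
        ← Real.rpow_add hA, ← Real.rpow_add hA]
      congr 1; push_cast; rw [hη]; ring
    calc 5 * (C * A) ^ 2 * Real.exp ((4 * L + 2) * s)
        ≤ 5 * (C * A) ^ 2 * A ^ (-(η / 3)) := by
          gcongr
          exact hexp _ _ _ (by positivity) (by rw [hK]; linarith [hK₃, hM]) (min_le_left _ _) hs
      _ = 5 * C ^ 2 * (A ^ 2 * A ^ (-(η / 3))) := by ring
      _ = 5 * C ^ 2 * A ^ η * ρ ^ 4 := by rw [e1]; ring
      _ ≤ 1 * ρ ^ 4 := by gcongr
      _ = _ := one_mul _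
  have htail : ∀ s ∈ Icc 0 (e₀ / K * |Real.log A|),
      |κ| * (P.real {β | R / 2 < ‖Z s β‖} / A ^ τ + q * (A ^ τ) ^ σ) ≤ R := by
    intro s hs
    have hAτ : 0 < A ^ τ := Real.rpow_pos_of_pos hA _
    have e1 : ρ ^ (4 * n) = A ^ (4 * n * η / 3) * R ^ (4 * n) := by
      rw [hρ, hR, ← Real.rpow_natCast, ← Real.rpow_natCast, ← Real.rpow_mul hA.le,
        ← Real.rpow_mul hA.le, ← Real.rpow_add hA]
      congr 1; push_cast; ring
    have h1 : P.real {β | R / 2 < ‖Z s β‖} ≤ 32 ^ n * (A * A ^ τ) := by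
      refine ((h.cloud s hs).measureReal_lt_norm_le ρ n (half_pos hR0)).trans ?_
      rw [div_le_iff₀ (by positivity)]
      calc _ ≤ (2 * ρ ^ 4) ^ n * A ^ (-1 : ℝ) := by
            refine (h.weight_moment_le hL hn1 hκ hρ0 hρ1 hδρ hJ hs).trans ?_
            gcongr
            exact hexp _ _ _ hK₂0 (by rw [hK]; linarith [hK₃, hM, hK₁]) (min_le_right _ _) hs
        _ = 2 ^ n * (A ^ (4 * n * η / 3) * A ^ (-1 : ℝ)) * R ^ (4 * n) := by
            rw [mul_pow, ← pow_mul, e1]; ring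
        _ ≤ 2 ^ n * (A * A ^ τ) * R ^ (4 * n) := by
            refine mul_le_mul_of_nonneg_right (mul_le_mul_of_nonneg_left ?_ (by positivity))
              (by positivity)
            nth_rewrite 3 [← Real.rpow_one A]
            rw [← Real.rpow_add hA, ← Real.rpow_add hA]
            exact Real.rpow_le_rpow_of_exponent_ge hA hA1 (by linarith)
        _ = 32 ^ n * (A * A ^ τ) * (R / 2) ^ (4 * n) := by
            rw [div_pow, pow_mul 2 4 n, show (32 : ℝ) = 2 * 2 ^ 4 by norm_num, mul_pow]
            field_simp
    have h2 : |κ| * (P.real {β | R / 2 < ‖Z s β‖} / A ^ τ) ≤ M * 32 ^ n * A := by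
      calc _ ≤ M * (32 ^ n * (A * A ^ τ) / A ^ τ) := by gcongr
        _ = _ := by field_simp
    have h3 : |κ| * (q * (A ^ τ) ^ σ) ≤ Q * A := by
      have e2 : (A ^ τ) ^ σ = A ^ (γ + 1) := by
        rw [← Real.rpow_mul hA.le, hτ, div_mul_cancel₀ _ hσ.ne']
      calc |κ| * (q * (A ^ τ) ^ σ) = |κ| * q * A ^ (γ + 1) := by rw [e2]; ring
        _ ≤ Q * A ^ (-γ) * A ^ (γ + 1) := by gcongr
        _ = Q * A := by
            rw [mul_assoc, ← Real.rpow_add hA, neg_add_cancel_left, Real.rpow_one]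
    have e3 : A = A ^ (1 - (a + η / 3)) * R := by
      rw [hR, ← Real.rpow_add hA]; norm_num
    calc _ = |κ| * (P.real {β | R / 2 < ‖Z s β‖} / A ^ τ) + |κ| * (q * (A ^ τ) ^ σ) := by ring
      _ ≤ M * 32 ^ n * A + Q * A := add_le_add h2 h3
      _ = (M * 32 ^ n + Q) * A := by ring
      _ = (M * 32 ^ n + Q) * A ^ (1 - (a + η / 3)) * R := by
          conv_lhs => rw [e3]
          ring
      _ ≤ 1 * R := by gcongr
      _ = R := one_mul _
  have hfin := h.sq_norm_le hL hκ hR0 (Real.rpow_pos_of_pos hA τ) hR1 (hδρ.trans hρR)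
    (fun s hs => (hJ s hs).trans (by gcongr)) htail ht hα
  refine lt_of_pow_lt_pow_left₀ 2 (Real.rpow_nonneg hA.le _) (hfin.trans_lt ?_)
  have e4 : R ^ 2 * A ^ (-(η / 3)) = A ^ (η / 3) * (A ^ a) ^ 2 := by
    rw [hR, ← Real.rpow_natCast, ← Real.rpow_natCast, ← Real.rpow_mul hA.le,
      ← Real.rpow_mul hA.le, ← Real.rpow_add hA, ← Real.rpow_add hA]
    congr 1; push_cast; ring
  have hAa : 0 < (A ^ a) ^ 2 := by positivity
  calc 2 * R ^ 2 * Real.exp ((24 * M + 4 * L + 5) * t) ≤ 2 * R ^ 2 * A ^ (-(η / 3)) := by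
        gcongr
        exact hexp _ _ _ (by positivity) (by rw [hK]; linarith [hK₁, hL]) (min_le_left _ _) ht
    _ = 2 * A ^ (η / 3) * (A ^ a) ^ 2 := by rw [mul_assoc, e4]; ring
    _ < (A ^ a) ^ 2 := by nlinarith

/-! ### Potentials of `L^p` densities -/

lemma lintegral_ball_inv_rpow_le {r s : ℝ} (hr : r < 2) (hs : 0 < s) :
    ∫⁻ y in Metric.ball (0 : Plane) s, ENNReal.ofReal ((1 / ‖y‖) ^ r)
      ≤ ENNReal.ofReal (2 * volume.real (Metric.ball (0 : Plane) 1) * (s ^ (2 - r) / (2 - r))) := by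
  set f : ℝ → ℝ := fun u => (1 / u) ^ r with hf
  have hpow : ∀ u ∈ Ioo 0 s, u ^ (Module.finrank ℝ Plane - 1) • f u = u ^ (1 - r) := by
    intro u hu
    simp only [finrank_euclideanSpace, Fintype.card_fin, hf, smul_eq_mul, one_div]
    rw [Real.inv_rpow hu.1.le, ← Real.rpow_neg hu.1.le, show 2 - 1 = 1 from rfl, pow_one,
      sub_eq_add_neg, Real.rpow_add hu.1, Real.rpow_one]
  have hint : IntervalIntegrable (fun u : ℝ => u ^ (1 - r)) volume 0 s :=
    intervalIntegral.intervalIntegrable_rpow' (by linarith)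
  have hon : IntegrableOn (fun x : Plane => f ‖x‖) (Metric.ball 0 s) := by
    rw [integrableOn_fun_norm_addHaar]
    exact (integrableOn_congr_fun hpow measurableSet_Ioo).2
      (((intervalIntegrable_iff_integrableOn_Ioc_of_le hs.le).1 hint).mono_set Ioo_subset_Ioc_self)
  have hval : ∫ x in Metric.ball (0 : Plane) s, f ‖x‖
      = 2 * volume.real (Metric.ball (0 : Plane) 1) * (s ^ (2 - r) / (2 - r)) := by
    have e1 : ∀ x : Plane, (Metric.ball (0 : Plane) s).indicator (fun x => f ‖x‖) x
        = (Iio s).indicator f ‖x‖ := fun x => by simp [indicator]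
    rw [← integral_indicator measurableSet_ball, integral_congr_ae (ae_of_all _ e1),
      integral_fun_norm_addHaar]
    have e2 : ∫ y in Ioi (0 : ℝ), y ^ (Module.finrank ℝ Plane - 1) • (Iio s).indicator f y
        = ∫ y in Ioo 0 s, y ^ (1 - r) := by
      rw [← integral_indicator measurableSet_Ioi, ← integral_indicator measurableSet_Ioo]
      congr 1
      ext y
      by_cases h1 : 0 < y <;> by_cases h2 : y < s
      · rw [indicator_of_mem (show y ∈ Ioi 0 from h1), indicator_of_mem (show y ∈ Iio s from h2),
          indicator_of_mem (show y ∈ Ioo 0 s from ⟨h1, h2⟩), hpow y ⟨h1, h2⟩]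
      all_goals simp [indicator, h1, h2]
    rw [e2, ← integral_Ioc_eq_integral_Ioo, ← intervalIntegral.integral_of_le hs.le,
      integral_rpow (Or.inl (by linarith))]
    simp only [finrank_euclideanSpace, Fintype.card_fin]
    rw [show 1 - r + 1 = 2 - r by ring, Real.zero_rpow (by linarith), sub_zero]
    simp [mul_assoc]
  rw [← hval, ofReal_integral_eq_lintegral_ofReal hon (ae_of_all _ fun x => by positivity)]

/-- Hölder's inequality for the cut-off potential of an `L^p` density in the plane, `p > 2`. -/
lemma exists_lintegral_potential_le {p : ℝ} (hp : 2 < p) :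
    ∃ c : ℝ, 0 ≤ c ∧ ∀ f : Plane → ℝ, AEStronglyMeasurable f volume → ∀ x : Plane, ∀ s : ℝ, 0 < s →
      ∫⁻ y in {y | ‖x - y‖ < s}, ‖f y‖ₑ * ENNReal.ofReal (1 / ‖x - y‖)
        ≤ eLpNorm f (ENNReal.ofReal p) volume * ENNReal.ofReal (c * s ^ (1 - 2 / p)) := by
  set r : ℝ := p / (p - 1) with hr
  have hpr : p.HolderConjugate r := .conjExponent (by linarith)
  have hr0 : 0 < r := hpr.symm.pos
  have hr2 : r < 2 := by rw [hr, div_lt_iff₀ (by linarith)]; linarith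
  set b : ℝ := 2 * volume.real (Metric.ball (0 : Plane) 1) / (2 - r) with hb
  have hb0 : 0 ≤ b := div_nonneg (by positivity) (by linarith)
  refine ⟨b ^ (1 / r), by positivity, fun f hf x s hs => ?_⟩
  have hm : MeasurableSet {y : Plane | ‖x - y‖ < s} :=
    (isOpen_lt (by fun_prop) continuous_const).measurableSet
  set g : Plane → ℝ≥0∞ := fun y => ENNReal.ofReal (1 / ‖x - y‖) with hg
  have hgm : Measurable g := by fun_prop
  have h1 := ENNReal.lintegral_mul_le_Lp_mul_Lq (volume.restrict {y : Plane | ‖x - y‖ < s}) hpr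
    (f := fun y => ‖f y‖ₑ) (g := g) hf.enorm.restrict hgm.aemeasurable
  refine h1.trans (mul_le_mul' ?_ ?_)
  · rw [eLpNorm_eq_lintegral_rpow_enorm_toReal (by simpa using (by linarith : 0 < p))
      ENNReal.ofReal_ne_top, ENNReal.toReal_ofReal (by linarith)]
    gcongr
    exact Measure.restrict_le_self
  · have h2 : ∫⁻ y in {y : Plane | ‖x - y‖ < s}, g y ^ r
        ≤ ENNReal.ofReal (b * s ^ (2 - r)) := by
      have e : ∫⁻ y in {y : Plane | ‖x - y‖ < s}, g y ^ r
          = ∫⁻ y in Metric.ball (0 : Plane) s, ENNReal.ofReal ((1 / ‖y‖) ^ r) := by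
        rw [← lintegral_indicator hm, ← lintegral_indicator measurableSet_ball,
          ← lintegral_sub_left_eq_self _ x]
        refine lintegral_congr fun y => ?_
        simp only [indicator, hg, mem_ofPred_eq, mem_ball_zero_iff, sub_sub_cancel,
          ENNReal.ofReal_rpow_of_nonneg (show 0 ≤ 1 / ‖y‖ by positivity) hr0.le]
      rw [e]
      refine (lintegral_ball_inv_rpow_le hr2 hs).trans (le_of_eq ?_)
      congr 1; rw [hb]; ring
    calc _ ≤ ENNReal.ofReal (b * s ^ (2 - r)) ^ (1 / r) := by gcongr
      _ = _ := by
        rw [ENNReal.ofReal_rpow_of_nonneg (by positivity) (by positivity),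
          Real.mul_rpow hb0 (by positivity), ← Real.rpow_mul hs.le]
        congr 3
        have hp1 : p - 1 ≠ 0 := by linarith
        have hp0 : p ≠ 0 := by linarith
        rw [hr]; field_simp; ring

/-! ### Essential supports -/

lemma ae_eq_zero_of_essSupport_subset {f : Plane → ℝ} {G : Set Plane}
    (h : essSupport f ⊆ G) : ∀ᵐ x, x ∉ G → f x = 0 := by
  rw [ae_iff]
  refine measure_null_of_locally_null _ fun x hx => ?_
  simp only [mem_ofPred_eq, Classical.not_imp] at hx
  have hx' : x ∉ essSupport f := fun h' => hx.1 (h h')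
  simp only [essSupport, mem_ofPred_eq, not_forall, not_not] at hx'
  obtain ⟨U, hU, hUf⟩ := hx'
  obtain ⟨V, hVU, hV, hxV⟩ := mem_nhds_iff.1 hU
  have h1 : ∀ᵐ y, y ∈ V → f y = 0 :=
    (ae_restrict_iff' hV.measurableSet).1 (ae_restrict_of_ae_restrict_of_subset hVU hUf)
  refine ⟨V ∩ {a | ¬(a ∉ G → f a = 0)}, Filter.inter_mem
    (mem_nhdsWithin_of_mem_nhds (hV.mem_nhds hxV)) self_mem_nhdsWithin, ?_⟩
  refine measure_mono_null (fun y hy => ?_) (ae_iff.1 h1)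
  simp only [mem_inter_iff, mem_ofPred_eq, Classical.not_imp] at hy ⊢
  exact ⟨hy.1, hy.2.2⟩

lemma essSupport_subset_of_ae_eq_zero {f : Plane → ℝ} {G : Set Plane} (hG : IsClosed G)
    (h : ∀ᵐ x, x ∉ G → f x = 0) : essSupport f ⊆ G := by
  intro x hx
  by_contra hxG
  exact hx Gᶜ (hG.isOpen_compl.mem_nhds hxG)
    ((ae_restrict_iff' hG.isOpen_compl.measurableSet).2 h)

/-- If a measure preserving map transports `f` to `g` and maps the particles that carry `f` into
a closed set, then that set carries `g`. -/
lemma essSupport_subset_of_transport {f g : Plane → ℝ} {X : Plane → Plane} {G : Set Plane}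
    (hX : MeasurePreserving X volume volume) (hg : AEMeasurable g volume)
    (hfg : ∀ᵐ α, g (X α) = f α) (hG : IsClosed G) (h : ∀ᵐ α, f α ≠ 0 → X α ∈ G) :
    essSupport g ⊆ G := by
  refine essSupport_subset_of_ae_eq_zero hG ?_
  have hN : NullMeasurableSet ({x | g x ≠ 0} ∩ Gᶜ) volume :=
    (hg.nullMeasurable (measurableSet_singleton (0 : ℝ)).compl).inter
      hG.measurableSet.compl.nullMeasurableSet
  have h1 : volume ({x | g x ≠ 0} ∩ Gᶜ) = 0 := by
    rw [← hX.measure_preimage hN]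
    have h2 : ∀ᵐ α, ¬(α ∈ X ⁻¹' ({x | g x ≠ 0} ∩ Gᶜ)) := by
      filter_upwards [hfg, h] with α h3 h4 h5
      simp only [mem_preimage, mem_inter_iff, mem_ofPred_eq, mem_compl_iff] at h5
      exact h5.2 (h4 (h3 ▸ h5.1))
    exact measure_eq_zero_iff_ae_notMem.2 h2
  rw [ae_iff]
  refine measure_mono_null (fun x hx => ?_) h1
  simp only [mem_inter_iff, mem_ofPred_eq, mem_compl_iff, Classical.not_imp] at hx ⊢
  exact ⟨hx.2, hx.1⟩

/-! ### Lagrangian description of the vortex -/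

/-- The normalised initial vorticity `ω₀ / ∫ ω₀`, as a probability measure on the particle
labels. -/
noncomputable def labelMeasure (ω₀ : Plane → ℝ) : Measure Plane :=
  volume.withDensity fun α => ENNReal.ofReal (ω₀ α / totalVorticity ω₀)

section Label

variable {ω₀ : Plane → ℝ}

lemma ae_nonneg_div_totalVorticity (hs : (∀ᵐ x, 0 ≤ ω₀ x) ∨ (∀ᵐ x, ω₀ x ≤ 0)) :
    ∀ᵐ x, 0 ≤ ω₀ x / totalVorticity ω₀ := by
  rcases hs with hs | hs
  · have : 0 ≤ totalVorticity ω₀ := integral_nonneg_of_ae hs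
    filter_upwards [hs] with x hx
    positivity
  · have : totalVorticity ω₀ ≤ 0 := integral_nonpos_of_ae hs
    filter_upwards [hs] with x hx
    exact div_nonneg_of_nonpos hx this

lemma isProbabilityMeasure_labelMeasure (hi : Integrable ω₀)
    (hs : (∀ᵐ x, 0 ≤ ω₀ x) ∨ (∀ᵐ x, ω₀ x ≤ 0)) (h0 : totalVorticity ω₀ ≠ 0) :
    IsProbabilityMeasure (labelMeasure ω₀) := by
  refine ⟨?_⟩
  rw [labelMeasure, withDensity_apply _ MeasurableSet.univ, Measure.restrict_univ,
    ← ofReal_integral_eq_lintegral_ofReal (hi.div_const _) (ae_nonneg_div_totalVorticity hs),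
    integral_div]
  change ENNReal.ofReal (totalVorticity ω₀ / totalVorticity ω₀) = 1
  rw [div_self h0, ENNReal.ofReal_one]

lemma smul_integral_labelMeasure {E : Type*} [NormedAddCommGroup E] [NormedSpace ℝ E]
    (hi : Integrable ω₀) (hs : (∀ᵐ x, 0 ≤ ω₀ x) ∨ (∀ᵐ x, ω₀ x ≤ 0))
    (h0 : totalVorticity ω₀ ≠ 0) (g : Plane → E) :
    totalVorticity ω₀ • ∫ α, g α ∂(labelMeasure ω₀) = ∫ α, ω₀ α • g α := by
  rw [labelMeasure, integral_withDensity_eq_integral_toReal_smul₀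
    (hi.aemeasurable.div_const _).ennreal_ofReal (ae_of_all _ fun _ => ENNReal.ofReal_lt_top),
    ← integral_smul]
  refine integral_congr_ae ?_
  filter_upwards [ae_nonneg_div_totalVorticity hs] with α hα
  rw [ENNReal.toReal_ofReal hα, smul_smul, mul_div_cancel₀ _ h0]

lemma ae_labelMeasure_of_ae (hi : Integrable ω₀) {p : Plane → Prop}
    (h : ∀ᵐ α, ω₀ α ≠ 0 → p α) : ∀ᵐ α ∂(labelMeasure ω₀), p α := by
  rw [labelMeasure, ae_withDensity_iff' (hi.aemeasurable.div_const _).ennreal_ofReal]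
  filter_upwards [h] with α hα hne
  refine hα fun h0 => hne ?_
  simp [h0]

/-- Eulerian and Lagrangian averages agree: an integral against the transported vorticity is an
average over the particles. -/
lemma integral_transport {E : Type*} [NormedAddCommGroup E] [NormedSpace ℝ E] {ω₁ : Plane → ℝ}
    {X : Plane → Plane} (hi : Integrable ω₀) (hs : (∀ᵐ x, 0 ≤ ω₀ x) ∨ (∀ᵐ x, ω₀ x ≤ 0))
    (h0 : totalVorticity ω₀ ≠ 0) (hX : MeasurePreserving X volume volume)
    (hω₁ : AEStronglyMeasurable ω₁ volume) (hω : ∀ᵐ α, ω₁ (X α) = ω₀ α) {g : Plane → E}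
    (hg : AEStronglyMeasurable g volume) :
    ∫ x, ω₁ x • g x = totalVorticity ω₀ • ∫ α, g (X α) ∂(labelMeasure ω₀) := by
  rw [smul_integral_labelMeasure hi hs h0]
  calc ∫ x, ω₁ x • g x = ∫ x, ω₁ x • g x ∂(volume.map X) := by rw [hX.map_eq]
    _ = ∫ α, ω₁ (X α) • g (X α) :=
        integral_map hX.measurable.aemeasurable (by rw [hX.map_eq]; exact hω₁.smul hg)
    _ = _ := by
        refine integral_congr_ae ?_
        filter_upwards [hω] with α hα
        rw [hα]

lemma lintegral_transport_le {ω₁ : Plane → ℝ} {X : Plane → Plane} (hi : Integrable ω₀)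
    (hX : MeasurePreserving X volume volume)
    (hω₁ : AEStronglyMeasurable ω₁ volume) (hω : ∀ᵐ α, ω₁ (X α) = ω₀ α) {g : Plane → ℝ≥0∞}
    (hg : Measurable g) :
    ∫⁻ α, g (X α) ∂(labelMeasure ω₀)
      ≤ ENNReal.ofReal |totalVorticity ω₀|⁻¹ * ∫⁻ x, ‖ω₁ x‖ₑ * g x := by
  have hgX : Measurable (fun α => g (X α)) := hg.comp hX.measurable
  rw [labelMeasure, lintegral_withDensity_eq_lintegral_mul₀
    (hi.aemeasurable.div_const _).ennreal_ofReal hgX.aemeasurable]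
  calc _ ≤ ∫⁻ α, ENNReal.ofReal |totalVorticity ω₀|⁻¹ * (‖ω₁ (X α)‖ₑ * g (X α)) := by
        refine lintegral_mono_ae ?_
        filter_upwards [hω] with α hα
        simp only [Pi.mul_apply]
        rw [← mul_assoc, hα]
        gcongr
        rw [← ofReal_norm, ← ENNReal.ofReal_mul (by positivity)]
        refine ENNReal.ofReal_le_ofReal ((le_abs_self _).trans (le_of_eq ?_))
        rw [abs_div, Real.norm_eq_abs]; ring
    _ = ENNReal.ofReal |totalVorticity ω₀|⁻¹ * ∫⁻ α, ‖ω₁ (X α)‖ₑ * g (X α) :=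
        lintegral_const_mul' _ _ ENNReal.ofReal_ne_top
    _ = ENNReal.ofReal |totalVorticity ω₀|⁻¹ * ∫⁻ x, ‖ω₁ x‖ₑ * g x ∂(volume.map X) := by
        rw [lintegral_map' (by rw [hX.map_eq]; exact hω₁.enorm.mul hg.aemeasurable)
          hX.measurable.aemeasurable]
    _ = _ := by rw [hX.map_eq]

end Label

lemma SpreadCloud.sub_const {S : Type*} [MeasurableSpace S] {P : Measure S} {z : S → Plane}
    {q σ : ℝ} (h : SpreadCloud P z q σ) (c : Plane) : SpreadCloud P (fun β => z β - c) q σ where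
  measurable := h.measurable.sub_const c
  nonneg := h.nonneg
  spread x s hs := by
    have e : ∀ β, x - (z β - c) = x + c - z β := fun β => by abel
    simp only [e]
    exact h.spread (x + c) s hs

lemma selfVelocity_sub_const {S : Type*} [MeasurableSpace S] (P : Measure S) (z : S → Plane)
    (x c : Plane) : selfVelocity P (fun β => z β - c) (x - c) = selfVelocity P z x := by
  simp only [selfVelocity, sub_sub_sub_cancel_right]

section Lagrangian

variable {ω₀ ω₁ : Plane → ℝ} {X : Plane → Plane}

lemma biotSavart_eq_smul_selfVelocity (hi : Integrable ω₀)
    (hs : (∀ᵐ x, 0 ≤ ω₀ x) ∨ (∀ᵐ x, ω₀ x ≤ 0)) (h0 : totalVorticity ω₀ ≠ 0)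
    (hX : MeasurePreserving X volume volume) (hω₁ : AEStronglyMeasurable ω₁ volume)
    (hω : ∀ᵐ α, ω₁ (X α) = ω₀ α) (x : Plane) :
    biotSavart ω₁ x
      = (totalVorticity ω₀ / (2 * Real.pi)) • selfVelocity (labelMeasure ω₀) X x := by
  have e : ∀ y, (ω₁ y / ‖x - y‖ ^ 2) • perp (x - y) = ω₁ y • kernel (x - y) := fun y => by
    rw [kernel, smul_smul, mul_one_div]
  have hk : AEStronglyMeasurable (fun y => kernel (x - y)) volume :=
    (measurable_kernel.comp (by fun_prop)).aestronglyMeasurable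
  rw [biotSavart]
  simp only [e]
  rw [integral_transport hi hs h0 hX hω₁ hω hk, smul_smul, one_div_mul_eq_div]
  rfl

/-- The `L^p` bound on the vorticity, `p > 2`, makes the cloud of particles spread. -/
lemma spreadCloud_of_eLpNorm_le {p c N : ℝ} (hi : Integrable ω₀) (hc0 : 0 ≤ c) (hN : 0 ≤ N)
    (hc : ∀ f : Plane → ℝ, AEStronglyMeasurable f volume → ∀ x : Plane, ∀ s : ℝ, 0 < s →
      ∫⁻ y in {y | ‖x - y‖ < s}, ‖f y‖ₑ * ENNReal.ofReal (1 / ‖x - y‖)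
        ≤ eLpNorm f (ENNReal.ofReal p) volume * ENNReal.ofReal (c * s ^ (1 - 2 / p)))
    (hX : MeasurePreserving X volume volume) (hω₁ : AEStronglyMeasurable ω₁ volume)
    (hω : ∀ᵐ α, ω₁ (X α) = ω₀ α)
    (hp : eLpNorm ω₁ (ENNReal.ofReal p) volume ≤ ENNReal.ofReal N) :
    SpreadCloud (labelMeasure ω₀) X (|totalVorticity ω₀|⁻¹ * (N * c)) (1 - 2 / p) where
  measurable := hX.measurable
  nonneg := by positivity
  spread x s hs := by
    have hm : MeasurableSet {y : Plane | ‖x - y‖ < s} :=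
      (isOpen_lt (by fun_prop) continuous_const).measurableSet
    have hgm : Measurable ({y : Plane | ‖x - y‖ < s}.indicator
        fun y => ENNReal.ofReal (1 / ‖x - y‖)) :=
      Measurable.indicator (by fun_prop) hm
    have h1 := lintegral_transport_le hi hX hω₁ hω hgm
    have e1 : ∫⁻ β in {β | ‖x - X β‖ < s}, ENNReal.ofReal (1 / ‖x - X β‖) ∂(labelMeasure ω₀)
        = ∫⁻ β, {y : Plane | ‖x - y‖ < s}.indicator
          (fun y => ENNReal.ofReal (1 / ‖x - y‖)) (X β) ∂(labelMeasure ω₀) := by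
      have hm' : MeasurableSet {β | ‖x - X β‖ < s} := hX.measurable hm
      rw [← lintegral_indicator hm']
      rfl
    have e2 : ∫⁻ y, ‖ω₁ y‖ₑ * {y : Plane | ‖x - y‖ < s}.indicator
          (fun y => ENNReal.ofReal (1 / ‖x - y‖)) y
        = ∫⁻ y in {y | ‖x - y‖ < s}, ‖ω₁ y‖ₑ * ENNReal.ofReal (1 / ‖x - y‖) := by
      rw [← lintegral_indicator hm]
      refine lintegral_congr fun y => ?_
      simp [indicator]
    rw [e1]
    refine h1.trans ?_
    rw [e2]
    calc _ ≤ ENNReal.ofReal |totalVorticity ω₀|⁻¹ *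
          (ENNReal.ofReal N * ENNReal.ofReal (c * s ^ (1 - 2 / p))) := by
          gcongr
          exact (hc ω₁ hω₁ x s hs).trans (by gcongr)
      _ = _ := by
          rw [← ENNReal.ofReal_mul hN, ← ENNReal.ofReal_mul (by positivity)]
          congr 1; ring

end Lagrangian

/-- Paths that start in a ball, relative to the path that starts at its centre, form a Lipschitz
flow as soon as their relative velocity grows at most linearly. -/
lemma isLipschitzFlow_of_ode {P : Measure Plane} {p₀ : Plane} {r T l b : ℝ}
    {Y V : ℝ → Plane → Plane}
    (hr : 0 ≤ r) (hl : 0 ≤ l) (hb : 0 ≤ b) (hP : ∀ᵐ α ∂P, α ∈ Metric.ball p₀ r)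
    (hm : ∀ t, 0 ≤ t → Measurable (Y t)) (h0 : ∀ α, Y 0 α = α - p₀)
    (hode : ∀ α, ∀ t, 0 ≤ t → HasDerivWithinAt (fun s => Y s α) (V t α) (Ici 0) t)
    (hV : ∀ α, ∀ t, 0 ≤ t → ‖V t α‖ ≤ l * ‖Y t α‖ + b) :
    IsLipschitzFlow P (Metric.ball p₀ r) T Y V := by
  have hcont : ∀ α, ContinuousOn (fun s => Y s α) (Icc 0 T) := fun α s hs =>
    (hode α s hs.1).continuousWithinAt.mono Icc_subset_Ici_self
  have hbound : ∀ α ∈ Metric.ball p₀ r, ∀ t ∈ Icc 0 T, ‖Y t α‖ ≤ gronwallBound r l b T := by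
    intro α hα t ht
    have h1 := norm_le_gronwallBound_of_norm_deriv_right_le (δ := r) (K := l) (ε := b) (hcont α)
      (fun s hs => (hode α s hs.1).mono (Ici_subset_Ici.2 hs.1))
      (by rw [h0, ← dist_eq_norm]; exact (Metric.mem_ball.1 hα).le)
      (fun s hs => hV α s hs.1) t ht
    refine h1.trans (gronwallBound_mono hr hb hl ?_)
    linarith [ht.2]
  refine ⟨hP, fun t ht => hm t ht.1, ⟨_, hbound⟩,
    ⟨(l * gronwallBound r l b T + b).toNNReal, fun α hα => ?_⟩, fun α _ t ht => ?_⟩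
  · refine Convex.lipschitzOnWith_of_nnnorm_hasDerivWithin_le (𝕜 := ℝ) (f' := fun t => V t α)
      (convex_Icc 0 T) (fun s hs => (hode α s hs.1).mono Icc_subset_Ici_self) fun s hs => ?_
    rw [← NNReal.coe_le_coe, coe_nnnorm]
    refine ((hV α s hs.1).trans ?_).trans (Real.le_coe_toNNReal _)
    gcongr
    exact hbound α hα s hs
  · exact (hode α t ht.1.le).hasDerivAt (Ici_mem_nhds ht.1)

/-- A vortex in a background flow, described by its particles in the frame of its centre: a disc
around the centre that contains all particles starting in `B_r(p₀)` contains the support. -/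
theorem IsVortexInBackground.exists_isCenteredVortex {ω : ℝ → Plane → ℝ}
    {F₁ F₂ : ℝ → Plane → Plane} (h : IsVortexInBackground ω F₁ F₂) {p₀ : Plane} {r δ p c N : ℝ}
    {L : ℝ≥0} (hF₁ : ∀ t : ℝ, 0 ≤ t → LipschitzWith L (F₁ t))
    (hF₂ : ∀ t : ℝ, 0 ≤ t → ∀ x, ‖F₂ t x‖ ≤ δ)
    (hs : (∀ᵐ x, 0 ≤ ω 0 x) ∨ (∀ᵐ x, ω 0 x ≤ 0)) (hsupp : essSupport (ω 0) ⊆ Metric.ball p₀ r)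
    (hr : 0 < r) (hrδ : r ≤ δ) (h0 : totalVorticity (ω 0) ≠ 0) (hc0 : 0 ≤ c) (hN : 0 ≤ N)
    (hc : ∀ f : Plane → ℝ, AEStronglyMeasurable f volume → ∀ x : Plane, ∀ s : ℝ, 0 < s →
      ∫⁻ y in {y | ‖x - y‖ < s}, ‖f y‖ₑ * ENNReal.ofReal (1 / ‖x - y‖)
        ≤ eLpNorm f (ENNReal.ofReal p) volume * ENNReal.ofReal (c * s ^ (1 - 2 / p)))
    (hp : eLpNorm (ω 0) (ENNReal.ofReal p) volume ≤ ENNReal.ofReal N) (T : ℝ) :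
    ∃ Z W : ℝ → Plane → Plane,
      IsCenteredVortex (labelMeasure (ω 0)) (Metric.ball p₀ r) T Z W
        (totalVorticity (ω 0) / (2 * Real.pi)) (|totalVorticity (ω 0)|⁻¹ * (N * c)) (1 - 2 / p)
        L δ ∧
      ∀ t ∈ Icc 0 T, ∀ R : ℝ, (∀ α ∈ Metric.ball p₀ r, ‖Z t α‖ ≤ R) →
        essSupport (ω t) ⊆ Metric.closedBall (vortexCenter ω t) R := by
  obtain ⟨X, hX, htr⟩ := h.transport
  have hi : Integrable (ω 0) := memLp_one_iff_integrable.1 h.memLp_one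
  set P := labelMeasure (ω 0) with hP
  have : IsProbabilityMeasure P := isProbabilityMeasure_labelMeasure hi hs h0
  set q : ℝ := |totalVorticity (ω 0)|⁻¹ * (N * c) with hq
  set κ : ℝ := totalVorticity (ω 0) / (2 * Real.pi) with hκ
  have hωm : ∀ t, 0 ≤ t → AEMeasurable (ω t) volume := fun t ht =>
    (h.rearrangement t ht).aemeasurable_fst
  have hball : ∀ᵐ α, ω 0 α ≠ 0 → α ∈ Metric.ball p₀ r := by
    filter_upwards [ae_eq_zero_of_essSupport_subset hsupp] with α hα hne
    by_contra hn
    exact hne (hα hn)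
  have hPB : ∀ᵐ α ∂P, α ∈ Metric.ball p₀ r := ae_labelMeasure_of_ae hi hball
  have hsp : ∀ t, 0 ≤ t → SpreadCloud P (X t) q (1 - 2 / p) := fun t ht =>
    spreadCloud_of_eLpNorm_le hi hc0 hN hc (hX.measurePreserving t ht)
      (hωm t ht).aestronglyMeasurable (htr t ht) ((h.rearrangement t ht).eLpNorm_eq _ ▸ hp)
  have hq0 : 0 ≤ q := (hsp 0 le_rfl).nonneg
  have hbs : ∀ t, 0 ≤ t → ∀ x, biotSavart (ω t) x = κ • selfVelocity P (X t) x := fun t ht =>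
    biotSavart_eq_smul_selfVelocity hi hs h0 (hX.measurePreserving t ht)
      (hωm t ht).aestronglyMeasurable (htr t ht)
  -- The frame of the particle starting at `p₀`, rather than a fixed one, is used because `F₁` is
  -- not assumed to be locally bounded in time.
  set Y : ℝ → Plane → Plane := fun t α => X t α - X t p₀ with hY
  set V : ℝ → Plane → Plane := fun t α =>
    velocity ω F₁ F₂ t (X t α) - velocity ω F₁ F₂ t (X t p₀) with hV
  have hδ0 : 0 ≤ δ := hr.le.trans hrδ
  have hVb : ∀ α, ∀ t, 0 ≤ t → ‖V t α‖ ≤ L * ‖Y t α‖ + (2 * (|κ| * (q + 1)) + 2 * δ) := by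
    intro α t ht
    have e : V t α = (κ • selfVelocity P (X t) (X t α) - κ • selfVelocity P (X t) (X t p₀))
        + (F₁ t (X t α) - F₁ t (X t p₀)) + (F₂ t (X t α) - F₂ t (X t p₀)) := by
      simp only [hV, velocity, hbs t ht]; abel
    have hu : ∀ x, ‖κ • selfVelocity P (X t) x‖ ≤ |κ| * (q + 1) := fun x => by
      rw [norm_smul, Real.norm_eq_abs]
      gcongr
      exact (hsp t ht).norm_selfVelocity_le x
    have h1 := norm_sub_le (κ • selfVelocity P (X t) (X t α)) (κ • selfVelocity P (X t) (X t p₀))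
    have h2 := (hF₁ t ht).norm_sub_le (X t α) (X t p₀)
    have h3 := norm_sub_le (F₂ t (X t α)) (F₂ t (X t p₀))
    rw [e]
    refine norm_add₃_le.trans ?_
    linarith [hu (X t α), hu (X t p₀), hF₂ t ht (X t α), hF₂ t ht (X t p₀)]
  have hflow : IsLipschitzFlow P (Metric.ball p₀ r) T Y V :=
    isLipschitzFlow_of_ode hr.le L.coe_nonneg (by positivity) hPB
      (fun t ht => (hX.measurePreserving t ht).measurable.sub_const _)
      (fun α => by simp only [hY, hX.initial])
      (fun α t ht => (hX.ode α t ht).sub (hX.ode p₀ t ht)) hVb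
  set Z : ℝ → Plane → Plane := fun t α => Y t α - ∫ β, Y t β ∂P with hZ
  set F : ℝ → Plane → Plane := fun t x => F₁ t x + F₂ t x with hF
  set W : ℝ → Plane → Plane := fun t α => F t (X t α) - ∫ β, F t (X t β) ∂P with hW
  have hYi : ∀ t ∈ Icc 0 T, Integrable (Y t) P := fun t ht =>
    hflow.integrable_comp continuous_id ht
  have hZX : ∀ t, Z t = fun α => X t α - (X t p₀ + ∫ β, Y t β ∂P) := fun t => by
    funext α; simp only [hZ, hY]; abel
  have hcenter : ∀ t ∈ Icc 0 T, vortexCenter ω t = X t p₀ + ∫ β, Y t β ∂P := by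
    intro t ht
    have h1 : ∫ α, X t α ∂P = X t p₀ + ∫ β, Y t β ∂P := by
      have e : ∀ α, X t α = X t p₀ + Y t α := fun α => by simp only [hY]; abel
      rw [integral_congr_ae (ae_of_all _ e), integral_add (integrable_const _) (hYi t ht)]
      simp
    rw [vortexCenter, integral_transport hi hs h0 (hX.measurePreserving t ht.1)
      (hωm t ht.1).aestronglyMeasurable (htr t ht.1) (g := fun x => x)
      aestronglyMeasurable_id, smul_smul, inv_mul_cancel₀ h0, one_smul, h1]
  have hself : ∀ t α, selfVelocity P (Z t) (Z t α) = selfVelocity P (X t) (X t α) := fun t α => by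
    rw [hZX]; exact selfVelocity_sub_const P (X t) (X t α) _
  have hcloud : ∀ t ∈ Icc 0 T, CenteredCloud P (Z t) q (1 - 2 / p) := by
    intro t ht
    have h1 : SpreadCloud P (Z t) q (1 - 2 / p) := by
      rw [hZX]; exact (hsp t ht.1).sub_const _
    refine { toSpreadCloud := h1, bounded := ?_, mean := ?_ }
    · obtain ⟨D, hD⟩ := hflow.centered.bounded
      refine ⟨D, ?_⟩
      filter_upwards [hPB] with α hα
      exact hD α hα t ht
    · simp only [hZ]
      rw [integral_sub (hYi t ht) (integrable_const _)]
      simp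
  have hVi : ∀ t ∈ Ioo 0 T, Integrable (fun α => F t (X t α)) P ∧ ∀ α,
      V t α - ∫ β, V t β ∂P = κ • selfVelocity P (Z t) (Z t α) + W t α := by
    intro t ht
    have ht' := Ioo_subset_Icc_self ht
    have hc := hcloud t ht'
    have i1 : Integrable (fun α => κ • selfVelocity P (Z t) (Z t α)) P :=
      (Integrable.of_bound hc.measurable_selfVelocity_comp.aestronglyMeasurable (q + 1)
        (ae_of_all _ fun α => hc.norm_selfVelocity_le _)).smul κ
    have e : ∀ α, V t α = κ • selfVelocity P (Z t) (Z t α)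
        + (F t (X t α) - velocity ω F₁ F₂ t (X t p₀)) := fun α => by
      rw [hself]
      simp only [hV, hF]
      rw [velocity, hbs t ht.1.le]
      abel
    have i2 : Integrable (fun α => F t (X t α)) P := by
      refine (((hflow.integrable_velocity ht).sub i1).add
        (integrable_const (velocity ω F₁ F₂ t (X t p₀)))).congr (ae_of_all _ fun α => ?_)
      simp only [Pi.add_apply, Pi.sub_apply, e α]
      abel
    have e2 : ∫ β, V t β ∂P = ∫ β, F t (X t β) ∂P - velocity ω F₁ F₂ t (X t p₀) := by
      have i3 : Integrable (fun α => F t (X t α) - velocity ω F₁ F₂ t (X t p₀)) P :=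
        i2.sub (integrable_const _)
      rw [integral_congr_ae (ae_of_all _ e), integral_add i1 i3,
        integral_sub i2 (integrable_const _), integral_smul, hc.integral_selfVelocity]
      simp
    refine ⟨i2, fun α => ?_⟩
    rw [e α, e2]
    simp only [hW]
    abel
  refine ⟨Z, W, ⟨?_, hcloud, ?_, ?_⟩, ?_⟩
  · refine { hflow.centered with deriv := fun α hα t ht => ?_ }
    rw [← (hVi t ht).2 α]
    exact hflow.centered.deriv α hα t ht
  · intro α _ t ht
    have ht' := Ioo_subset_Icc_self ht
    have iZ : Integrable (fun β => ‖Z t β‖) P :=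
      hflow.centered.integrable_comp continuous_norm ht'
    have e1 : W t α = ∫ β, (F t (X t α) - F t (X t β)) ∂P := by
      rw [integral_sub (integrable_const _) (hVi t ht).1]
      simp [hW]
    have e2 : ∫ β, ((L * ‖Z t α‖ + 2 * δ) + L * ‖Z t β‖) ∂P
        = L * ‖Z t α‖ + L * (∫ β, ‖Z t β‖ ∂P) + 2 * δ := by
      rw [integral_add (integrable_const _) (iZ.const_mul _), integral_const_mul]
      simp; ring
    rw [e1, ← e2]
    refine norm_integral_le_of_norm_le ((integrable_const _).add (iZ.const_mul _))
      (ae_of_all _ fun β => ?_)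
    have e3 : F t (X t α) - F t (X t β) = (F₁ t (X t α) - F₁ t (X t β))
        + (F₂ t (X t α) - F₂ t (X t β)) := by simp only [hF]; abel
    have e4 : X t α - X t β = Z t α - Z t β := by simp only [hZ, hY]; abel
    have h1 := (hF₁ t ht.1.le).norm_sub_le (X t α) (X t β)
    rw [e4] at h1
    have h2 := norm_sub_le (F₂ t (X t α)) (F₂ t (X t β))
    have h3 : (L : ℝ) * ‖Z t α - Z t β‖ ≤ L * (‖Z t α‖ + ‖Z t β‖) := by
      gcongr; exact norm_sub_le _ _
    rw [e3]
    refine (norm_add_le _ _).trans ?_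
    linarith [hF₂ t ht.1.le (X t α), hF₂ t ht.1.le (X t β)]
  · intro α hα
    have h1 : ∀ β ∈ Metric.ball p₀ r, ‖Y 0 β‖ ≤ δ := fun β hβ => by
      simp only [hY, hX.initial]
      rw [← dist_eq_norm]
      exact (Metric.mem_ball.1 hβ).le.trans hrδ
    have h2 : ‖∫ β, Y 0 β ∂P‖ ≤ δ := by
      refine (norm_integral_le_of_norm_le_const (C := δ) ?_).trans (by simp)
      filter_upwards [hPB] with β hβ
      exact h1 β hβ
    refine (norm_sub_le _ _).trans ?_
    linarith [h1 α hα]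
  · intro t ht R hR
    refine essSupport_subset_of_transport (hX.measurePreserving t ht.1) (hωm t ht.1) (htr t ht.1)
      Metric.isClosed_closedBall ?_
    filter_upwards [hball] with α hα hne
    rw [Metric.mem_closedBall, dist_eq_norm, hcenter t ht]
    have := hR α (hα hne)
    rwa [hZX] at this

/-- A vortex without circulation is trivial. -/
lemma IsVortexInBackground.essSupport_eq_empty {ω : ℝ → Plane → ℝ} {F₁ F₂ : ℝ → Plane → Plane}
    (h : IsVortexInBackground ω F₁ F₂) (hs : (∀ᵐ x, 0 ≤ ω 0 x) ∨ (∀ᵐ x, ω 0 x ≤ 0))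
    (h0 : totalVorticity (ω 0) = 0) {t : ℝ} (ht : 0 ≤ t) : essSupport (ω t) = ∅ := by
  obtain ⟨X, hX, htr⟩ := h.transport
  have hi : Integrable (ω 0) := memLp_one_iff_integrable.1 h.memLp_one
  have hz : ∀ᵐ α, ω 0 α = 0 := by
    rcases hs with hs | hs
    · exact (integral_eq_zero_iff_of_nonneg_ae hs hi).1 h0
    · have h1 : ∫ x, -ω 0 x = 0 := by rw [integral_neg]; exact neg_eq_zero.2 h0
      have h2 := (integral_eq_zero_iff_of_nonneg_ae
        (hs.mono fun x hx => neg_nonneg.2 hx) hi.neg).1 h1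
      filter_upwards [h2] with α hα
      simpa using hα
  refine subset_empty_iff.1 (essSupport_subset_of_transport (hX.measurePreserving t ht)
    (h.rearrangement t ht).aemeasurable_fst (htr t ht) isClosed_empty ?_)
  filter_upwards [hz] with α hα hne
  exact absurd hα hne

end PointVortex

/-! ### Confinement of the vortex -/

theorem mainTheorem8
    (ω : ℝ → ℝ → PointVortex.Plane → ℝ)
    (F₁ F₂ : ℝ → ℝ → PointVortex.Plane → PointVortex.Plane)
    (A : ℝ → ℝ) (p₀ : PointVortex.Plane) (L : ℝ≥0) (C M γ p₁ : ℝ)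
    (hC : 0 < C) (hγ : 0 < γ) (hp₁ : 2 < p₁)
    -- `ω ε` is a vortex in the background flow `F₁ ε + F₂ ε`
    (hω : ∀ᶠ ε in 𝓝[>] (0 : ℝ), PointVortex.IsVortexInBackground (ω ε) (F₁ ε) (F₂ ε))
    -- `F₁` is Lipschitz in space, uniformly in `ε` and `t`
    (hF₁ : ∀ᶠ ε in 𝓝[>] (0 : ℝ), ∀ t : ℝ, 0 ≤ t → LipschitzWith L (F₁ ε t))
    (hF₂_meas : ∀ᶠ ε in 𝓝[>] (0 : ℝ), ∀ t : ℝ, 0 ≤ t →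
      AEStronglyMeasurable (F₂ ε t) volume)
    -- the initial vorticity has one sign and is supported in `B_ε(p₀)`
    (hsign : ∀ᶠ ε in 𝓝[>] (0 : ℝ), (∀ᵐ x, 0 ≤ ω ε 0 x) ∨ (∀ᵐ x, ω ε 0 x ≤ 0))
    (hsupp : ∀ᶠ ε in 𝓝[>] (0 : ℝ),
      PointVortex.essSupport (ω ε 0) ⊆ Metric.ball p₀ ε)
    -- the total vorticities are bounded
    (htotal : ∀ᶠ ε in 𝓝[>] (0 : ℝ), |PointVortex.totalVorticity (ω ε 0)| ≤ M)
    -- `A ε → 0`, `max {ε, ‖F₂ ε‖_∞} ≤ C A ε` and `‖ω ε 0‖_{p₁} ≤ (A ε)^{-γ}`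
    (hA : Tendsto A (𝓝[>] (0 : ℝ)) (𝓝 0))
    (hAε : ∀ᶠ ε in 𝓝[>] (0 : ℝ), ε ≤ C * A ε)
    (hAF₂ : ∀ᶠ ε in 𝓝[>] (0 : ℝ), ∀ t : ℝ, 0 ≤ t → ∀ x, ‖F₂ ε t x‖ ≤ C * A ε)
    (hLp : ∀ᶠ ε in 𝓝[>] (0 : ℝ),
      eLpNorm (ω ε 0) (ENNReal.ofReal p₁) volume ≤ ENNReal.ofReal (A ε ^ (-γ)))
    (a : ℝ) (ha : a < 1 / 2) :
    ∃ ε₀ : ℝ, 0 < ε₀ ∧ ∃ c₀ : ℝ, 0 < c₀ ∧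
      ∀ ε : ℝ, 0 < ε → ε ≤ ε₀ → ∀ t : ℝ, 0 ≤ t → t ≤ c₀ * |Real.log (A ε)| →
        PointVortex.essSupport (ω ε t) ⊆
          Metric.ball (PointVortex.vortexCenter (ω ε) t) (A ε ^ a) := by
  obtain ⟨c, hc0, hc⟩ := PointVortex.exists_lintegral_potential_le hp₁
  -- a positive exponent between `a` and `1 / 2`
  obtain ⟨b, hab, hb⟩ : ∃ b, max a 0 < b ∧ b < 1 / 2 := exists_between (by simpa using ha)
  have hab' : a < b := (le_max_left _ _).trans_lt hab
  have hb0 : 0 < b := (le_max_right _ _).trans_lt hab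
  have hσ : 0 < 1 - 2 / p₁ := by
    have : 2 / p₁ < 1 := by rw [div_lt_one (by linarith)]; exact hp₁
    linarith
  obtain ⟨c₀, hc₀, hev⟩ := PointVortex.exists_forall_norm_lt (S := PointVortex.Plane) (C := C)
    (Q := c) L.coe_nonneg (le_max_right M 0) hγ hσ hb0 hb
  have hApos : ∀ᶠ ε in 𝓝[>] (0 : ℝ), 0 < A ε := by
    filter_upwards [hAε, self_mem_nhdsWithin] with ε h1 h2
    exact pos_of_mul_pos_right ((show 0 < ε from h2).trans_le h1) hC.le
  have hA' : Tendsto A (𝓝[>] (0 : ℝ)) (𝓝[>] 0) := tendsto_nhdsWithin_iff.2 ⟨hA, hApos⟩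
  have hmain : ∀ᶠ ε in 𝓝[>] (0 : ℝ), ∀ t : ℝ, 0 ≤ t → t ≤ c₀ * |Real.log (A ε)| →
      PointVortex.essSupport (ω ε t) ⊆
        Metric.ball (PointVortex.vortexCenter (ω ε) t) (A ε ^ a) := by
    filter_upwards [hω, hF₁, hsign, hsupp, htotal, hAε, hAF₂, hLp, hApos, hA'.eventually hev,
      hA.eventually (gt_mem_nhds one_pos), self_mem_nhdsWithin]
      with ε hω hF₁ hsign hsupp htotal hAε hAF₂ hLp hApos hev hA1 hε t ht htc
    by_cases h0 : PointVortex.totalVorticity (ω ε 0) = 0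
    · rw [hω.essSupport_eq_empty hsign h0 ht]
      exact empty_subset _
    have hN : 0 ≤ A ε ^ (-γ) := Real.rpow_nonneg hApos.le _
    have hi : Integrable (ω ε 0) := memLp_one_iff_integrable.1 hω.memLp_one
    have := PointVortex.isProbabilityMeasure_labelMeasure hi hsign h0
    obtain ⟨Z, W, hZ, hZs⟩ := hω.exists_isCenteredVortex hF₁ hAF₂ hsign hsupp hε hAε h0 hc0 hN hc
      hLp (c₀ * |Real.log (A ε)|)
    have h2π : 1 ≤ 2 * Real.pi := by linarith [Real.pi_gt_three]
    have hκ : |PointVortex.totalVorticity (ω ε 0) / (2 * Real.pi)|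
        ≤ |PointVortex.totalVorticity (ω ε 0)| := by
      rw [abs_div, abs_of_pos (by positivity : 0 < 2 * Real.pi)]
      exact div_le_self (abs_nonneg _) h2π
    have hlt := hev _ _ Z W _ _ hZ (hκ.trans (htotal.trans (le_max_left _ _))) (by
      calc _ ≤ |PointVortex.totalVorticity (ω ε 0)|
            * (|PointVortex.totalVorticity (ω ε 0)|⁻¹ * (A ε ^ (-γ) * c)) := by gcongr
        _ = c * A ε ^ (-γ) := by
          rw [mul_inv_cancel_left₀ (abs_ne_zero.2 h0), mul_comm]) t ⟨ht, htc⟩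
    refine (hZs t ⟨ht, htc⟩ (A ε ^ b) fun α hα => (hlt α hα).le).trans ?_
    exact Metric.closedBall_subset_ball (Real.rpow_lt_rpow_of_exponent_gt hApos hA1 hab')
  obtain ⟨ε₀, hε₀, hsub⟩ := mem_nhdsGT_iff_exists_Ioc_subset.1 hmain
  exact ⟨ε₀, hε₀, c₀, hc₀, fun ε h1 h2 => hsub ⟨h1, h2⟩⟩
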